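/- Let $d\ge 0$ and let $|\cdot|$ be a norm on $\mathbb{R}^d$. Let $H$ be a (possibly unbounded) self-adjoint operator on $\ell^2(\mathbb{Z}^d)$ whose domain contains the basis vectors $|x\rangle$, $x\in\mathbb{Z}^d$, and whose matrix elements are $$\langle x|H|y\rangle = K_{x,y}+(U_x+\lambda V_x)\,\delta_{x,y},$$ where $U$ and $V$ are real functions on $\mathbb{Z}^d$ (for instance a periodic potential and a realization of a random potential), $\lambda\in\mathbb{R}$, and the complex hopping terms $K_{x,y}$ satisfy $|K_{x+a,y+a}|=|K_{x,y}|$ for all $a,x,y\in\mathbb{Z}^d$ (as is the case when $K_{x,y}$ depends only on $x-y$, and when $K_{x,y}=e^{-i\mathcal{A}_{x,y}}\delta_{|x-y|,1}$ with real phases $\mathcal{A}_{x,y}$). Let $\eta>0$, and let $F$ be analytic and bounded in the strip $|\mathrm{Im}\,z|<\eta$, with $\|F\|_\infty=\sup_{|\mathrm{Im}\,z|<\eta}|F(z)|$. Then for every $\mu\in\mathbb{R}$ such that the series $$b(\mu)=\sum_{x\in\mathbb{Z}^d}|K_{0,x}|\,\bigl(e^{\mu|x|}-1\bigr)$$ converges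 and $b(\mu)\le\eta/2$, and for all $x,y\in\mathbb{Z}^d$, $$|\langle x|F(H)|y\rangle|\le 18\sqrt2\,\|F\|_\infty\,e^{-\mu|x-y|},$$ where $F(H)$ is given by the spectral calculus of the self-adjoint operator $H$. -/

import Mathlib

open scoped CompactlySupported

noncomputable section

namespace SelfAdjointCalculus

variable {E : Type*} [NormedAddCommGroup E] [InnerProductSpace ℂ E]

/-- The map `(ψ, Hψ) ↦ Hψ + s ψ` on the graph of the operator `H`. -/
def shift (H : E →ₗ.[ℂ] E) (s : ℂ) : H.graph →L[ℂ] E :=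
  (ContinuousLinearMap.snd ℂ E E + s • ContinuousLinearMap.fst ℂ E E).comp H.graph.subtypeL

theorem shift_apply (H : E →ₗ.[ℂ] E) (s : ℂ) (g : H.graph) :
    shift H s g = (g : E × E).2 + s • (g : E × E).1 := rfl

variable [CompleteSpace E]

theorem graph_inner {H : E →ₗ.[ℂ] E} (hH : IsSelfAdjoint H) (g h : H.graph) :
    inner ℂ (g : E × E).2 (h : E × E).1 = inner ℂ (g : E × E).1 (h : E × E).2 := by
  obtain ⟨g, hg⟩ := g
  obtain ⟨h, hh⟩ := h
  obtain ⟨a, ha1, ha2⟩ := LinearPMap.mem_graph_iff H |>.1 hg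
  obtain ⟨b, hb1, hb2⟩ := LinearPMap.mem_graph_iff H |>.1 hh
  have key := LinearPMap.adjoint_isFormalAdjoint hH.dense_domain
  rw [LinearPMap.isSelfAdjoint_def.1 hH] at key
  have := key a b
  simp only [← ha1, ← ha2, ← hb1, ← hb2]
  exact this

theorem shift_norm_sq {H : E →ₗ.[ℂ] E} (hH : IsSelfAdjoint H) {s : ℂ}
    (hs : s = Complex.I ∨ s = -Complex.I) (g : H.graph) :
    ‖shift H s g‖ ^ 2 = ‖(g : E × E).2‖ ^ 2 + ‖(g : E × E).1‖ ^ 2 := by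
  have hre : (inner ℂ (g : E × E).2 (g : E × E).1).im = 0 := by
    have h1 := graph_inner hH g g
    have h2 := inner_conj_symm (𝕜 := ℂ) (g : E × E).2 (g : E × E).1
    rw [← h1] at h2
    exact Complex.conj_eq_iff_im.1 h2
  have hn : ‖s‖ = 1 := by rcases hs with rfl | rfl <;> simp
  rw [shift_apply, @norm_add_sq ℂ, inner_smul_right, norm_smul, hn, one_mul]
  have : RCLike.re (s * inner ℂ (g : E × E).2 (g : E × E).1) = 0 := by
    rcases hs with rfl | rfl <;> simp [hre]
  rw [this]
  ring

theorem shift_bijective {H : E →ₗ.[ℂ] E} (hH : IsSelfAdjoint H) {s : ℂ}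
    (hs : s = Complex.I ∨ s = -Complex.I) : Function.Bijective (shift H s) := by
  have hanti : AntilipschitzWith 1 (shift H s) := by
    refine AddMonoidHomClass.antilipschitz_of_bound _ fun g => ?_
    have h := shift_norm_sq hH hs g
    rw [NNReal.coe_one, one_mul]
    change max ‖(g : E × E).1‖ ‖(g : E × E).2‖ ≤ _
    refine max_le ?_ ?_ <;> refine le_of_sq_le_sq ?_ (norm_nonneg _) <;>
      nlinarith [sq_nonneg ‖(g : E × E).1‖, sq_nonneg ‖(g : E × E).2‖]
  have hcl : IsClosed (H.graph : Set (E × E)) := hH.isClosed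
  have : CompleteSpace H.graph := hcl.completeSpace_coe
  have hrc : IsClosed ((shift H s).range : Set E) := by
    exact hanti.isClosed_range (shift H s).uniformContinuous
  refine ⟨hanti.injective, ?_⟩
  have : CompleteSpace (shift H s).range := hrc.completeSpace_coe
  have htop : (shift H s).range = ⊤ := by
    rw [← Submodule.orthogonal_eq_bot_iff, Submodule.eq_bot_iff]
    intro φ hφ
    rw [Submodule.mem_orthogonal'] at hφ
    have h1 : ∀ x : H.domain, inner ℂ (s • φ) (x : E) = inner ℂ φ (H x) := by
      intro x
      have := hφ (shift H s ⟨((x : E), H x), H.mem_graph x⟩) ⟨_, rfl⟩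
      rw [shift_apply, inner_add_right, inner_smul_right] at this
      rw [inner_smul_left]
      have hc : (starRingEnd ℂ) s = -s := by rcases hs with rfl | rfl <;> simp
      rw [hc]
      linear_combination -this
    have hd := LinearPMap.mem_adjoint_domain_of_exists (T := H) φ ⟨_, h1⟩
    have he := LinearPMap.adjoint_apply_eq hH.dense_domain ⟨φ, hd⟩ h1
    have hmem : (φ, s • φ) ∈ H.adjoint.graph := by
      rw [← he]; exact H.adjoint.mem_graph ⟨φ, hd⟩
    rw [LinearPMap.isSelfAdjoint_def.1 hH] at hmem
    have h2 := shift_norm_sq hH (s := -s) (by rcases hs with rfl | rfl <;> simp) ⟨_, hmem⟩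
    rw [shift_apply] at h2
    simp only [neg_smul, add_neg_cancel, norm_zero] at h2
    have : ‖φ‖ ^ 2 = 0 := by nlinarith [sq_nonneg ‖φ‖, sq_nonneg ‖s • φ‖]
    simpa using this
  intro φ
  have : φ ∈ (shift H s).range := htop ▸ Submodule.mem_top
  exact this

/-- The bijection `(ψ, Hψ) ↦ Hψ + s ψ` from the graph of a self-adjoint `H` onto the whole
space, for `s = ± i`. -/
def shiftEquiv (H : E →ₗ.[ℂ] E) (hH : IsSelfAdjoint H) (s : ℂ)
    (hs : s = Complex.I ∨ s = -Complex.I) : H.graph ≃L[ℂ] E :=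
  haveI : CompleteSpace H.graph := IsClosed.completeSpace_coe (hs := hH.isClosed)
  ContinuousLinearEquiv.ofBijective (shift H s)
    (LinearMap.ker_eq_bot.2 (shift_bijective hH hs).1)
    (LinearMap.range_eq_top.2 (shift_bijective hH hs).2)

/-- The Cayley transform `(H - i)(H + i)⁻¹` of a (possibly unbounded) self-adjoint operator,
that is, the everywhere defined operator `Hψ + iψ ↦ Hψ - iψ`. -/
def cayley (H : E →ₗ.[ℂ] E) (hH : IsSelfAdjoint H) : E →L[ℂ] E :=
  (shift H (-Complex.I)).comp
    (shiftEquiv H hH Complex.I (Or.inl rfl)).symm.toContinuousLinearMap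

theorem cayley_apply (H : E →ₗ.[ℂ] E) (hH : IsSelfAdjoint H) (ψ : H.domain) :
    cayley H hH (H ψ + Complex.I • (ψ : E)) = H ψ - Complex.I • (ψ : E) := by
  have h : (shiftEquiv H hH Complex.I (Or.inl rfl)).symm (H ψ + Complex.I • (ψ : E)) =
      ⟨((ψ : E), H ψ), H.mem_graph ψ⟩ := by
    rw [ContinuousLinearEquiv.symm_apply_eq]
    rfl
  change shift H (-Complex.I) ((shiftEquiv H hH Complex.I (Or.inl rfl)).symm _) = _
  rw [h, shift_apply, neg_smul, sub_eq_add_neg]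

/-- The Cayley transform is unitary, so that its continuous functional calculus is available. -/
theorem cayley_mem_unitary (H : E →ₗ.[ℂ] E) (hH : IsSelfAdjoint H) :
    cayley H hH ∈ unitary (E →L[ℂ] E) := by
  set S := shiftEquiv H hH Complex.I (Or.inl rfl) with hS
  have hn : ∀ φ, ‖cayley H hH φ‖ = ‖φ‖ := by
    intro φ
    have h1 := shift_norm_sq hH (s := -Complex.I) (Or.inr rfl) (S.symm φ)
    have h2 := shift_norm_sq hH (s := Complex.I) (Or.inl rfl) (S.symm φ)
    have h3 : shift H Complex.I (S.symm φ) = φ := S.apply_symm_apply φ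
    rw [h3, ← h1] at h2
    exact ((sq_eq_sq₀ (norm_nonneg _) (norm_nonneg _)).1 h2).symm
  have h1 := (ContinuousLinearMap.norm_map_iff_adjoint_comp_self _).1 hn
  have hsurj : Function.Surjective (cayley H hH) :=
    (shift_bijective hH (Or.inr rfl)).2.comp S.symm.surjective
  refine Unitary.mem_iff.2 ⟨h1, ?_⟩
  ext φ
  obtain ⟨χ, rfl⟩ := hsurj φ
  have := congrArg (fun T : E →L[ℂ] E => cayley H hH (T χ)) h1
  exact this

open scoped ComplexOrder in
/-- The positive functional `f ↦ ⟨ψ, f(V) ψ⟩` on continuous compactly supported functions of the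
complex plane, where `V` is the (unitary) Cayley transform of `H`. -/
def cayleyFunctional (H : E →ₗ.[ℂ] E) (hH : IsSelfAdjoint H) (ψ : E) : C_c(ℂ, ℝ) →ₚ[ℝ] ℝ :=
  PositiveLinearMap.mk₀
    { toFun := fun f => (inner ℂ ψ (cfc (fun z => (f z : ℂ)) (cayley H hH) ψ)).re
      map_add' := by
        intro f g
        have := cfc_add (cayley H hH) (fun z => (f z : ℂ)) (fun z => (g z : ℂ))
          (by fun_prop) (by fun_prop)
        simp only [CompactlySupportedContinuousMap.coe_add, Pi.add_apply, Complex.ofReal_add]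
        rw [this]
        simp
      map_smul' := by
        intro c f
        have := cfc_const_mul (c : ℂ) (fun z => (f z : ℂ)) (cayley H hH) (by fun_prop)
        simp only [CompactlySupportedContinuousMap.coe_smul, Pi.smul_apply, smul_eq_mul,
          Complex.ofReal_mul]
        rw [this]
        simp }
    (by
      intro f hf
      have h0 : (0 : E →L[ℂ] E) ≤ cfc (fun z => (f z : ℂ)) (cayley H hH) :=
        cfc_nonneg fun z _ => by exact_mod_cast hf z
      have := (ContinuousLinearMap.nonneg_iff_isPositive _).1 h0
      exact this.re_inner_nonneg_right ψ)

/-- The inverse of the Cayley map `t ↦ (t - i)/(t + i)` from the real line to the unit circle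
without the point `1`. -/
def cayleyInv (w : ℂ) : ℝ := (Complex.I * (1 + w) / (1 - w)).re

/-- The spectral measure `μ_ψ = ⟨ψ, E_H(·) ψ⟩` of a self-adjoint operator `H` at the vector `ψ`:
the Riesz-Markov measure of `f ↦ ⟨ψ, f(V) ψ⟩`, with `V` the Cayley transform of `H`, transported
from the unit circle to the real line. -/
def spectralMeasure (H : E →ₗ.[ℂ] E) (hH : IsSelfAdjoint H) (ψ : E) : MeasureTheory.Measure ℝ :=
  (RealRMK.rieszMeasure (cayleyFunctional H hH ψ)).map cayleyInv

/-- The matrix element `⟨φ, F(H) ψ⟩ = ∫ F dμ_{φ,ψ}` of the function `F(H)` of a self-adjoint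
operator, the complex spectral measure `μ_{φ,ψ} = ⟨φ, E_H(·) ψ⟩` being expressed through the
positive measures `μ_χ` by polarization. -/
def matrixElement (H : E →ₗ.[ℂ] E) (hH : IsSelfAdjoint H) (F : ℝ → ℂ) (φ ψ : E) : ℂ :=
  (1 / 4 : ℂ) *
    ((∫ t, F t ∂(spectralMeasure H hH (φ + ψ)))
      - (∫ t, F t ∂(spectralMeasure H hH (φ - ψ)))
      - Complex.I * (∫ t, F t ∂(spectralMeasure H hH (φ + Complex.I • ψ)))
      + Complex.I * (∫ t, F t ∂(spectralMeasure H hH (φ - Complex.I • ψ))))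

end SelfAdjointCalculus

namespace LatticeHamiltonian

/-- The Hilbert space `ℓ²(ℤ^d)`. -/
abbrev Hilb (d : ℕ) := lp (fun _ : Fin d → ℤ => ℂ) 2

/-- The basis vector `|x⟩` of `ℓ²(ℤ^d)` at the site `x`. -/
def ket {d : ℕ} (x : Fin d → ℤ) : Hilb d := lp.single 2 x (1 : ℂ)

/-- The length of a lattice vector in the norm `N` of `ℝ^d`. -/
def len {d : ℕ} (N : Seminorm ℝ (Fin d → ℝ)) (x : Fin d → ℤ) : ℝ := N (fun i => (x i : ℝ))

/-- `H` is a self-adjoint operator in `ℓ²(ℤ^d)`, possibly unbounded, whose domain contains the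
basis vectors and whose matrix elements are `⟨x|H|y⟩ = K_{x,y} + (U_x + lam * V_x) δ_{x,y}`. -/
structure IsHamiltonian {d : ℕ} (K : (Fin d → ℤ) → (Fin d → ℤ) → ℂ) (U : (Fin d → ℤ) → ℝ)
    (lam : ℝ) (V : (Fin d → ℤ) → ℝ) (H : Hilb d →ₗ.[ℂ] Hilb d) : Prop where
  selfAdjoint : IsSelfAdjoint H
  ket_mem : ∀ x, ket x ∈ H.domain
  matrix : ∀ x y, inner ℂ (ket x) (H ⟨ket y, ket_mem y⟩) =
    K x y + if x = y then ((U x + lam * V x : ℝ) : ℂ) else 0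

/-- The terms of the series `b(μ) = ∑_x |K_{0,x}| (e^{μ|x|} - 1)`. -/
def bTerm {d : ℕ} (N : Seminorm ℝ (Fin d → ℝ)) (K : (Fin d → ℤ) → (Fin d → ℤ) → ℂ) (μ : ℝ)
    (x : Fin d → ℤ) : ℝ := ‖K 0 x‖ * (Real.exp (μ * len N x) - 1)

/-- The open strip `|Im z| < η`. -/
def strip (η : ℝ) : Set ℂ := {z | |z.im| < η}

/-- The supremum norm of `F` on the strip `|Im z| < η`. -/
def supNorm (η : ℝ) (F : ℂ → ℂ) : ℝ := sSup ((fun z => ‖F z‖) '' strip η)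

end LatticeHamiltonian

end

/-! The estimate combines a Cauchy formula on a strip with a Combes-Thomas bound, arranged so that
an unbounded `H` costs nothing.

Put `b = 3η/4`. Cauchy's formula on `|Im z| ≤ b`, applied to `F` times a rational factor equal to
`1` at the point of evaluation, writes `F(t)` as an integral over `u ∈ ℝ` of `F(u ± ib)` times a
product of three simple fractions in `t` (`integral_stripKernel`). Integrating against the spectral
measures turns each product into three resolvents: outer ones at `u + ib` and `u - ib`, a middle one
at `u ± 3ib` (`matrixElement_eq_integral`). The outer resolvents make the `u`-integral converge,
because `∫ ‖(H - u - ib)⁻¹φ‖² du = (π/b)‖φ‖²` (`integral_norm_resolvent_sq`), which is the integral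
of a Poisson kernel against the spectral measure.

Decay comes from inserting `e^{-f} e^{f}` after the first resolvent, where `f` is bounded, `f(y) =
0`, `f(x) = μ|x-y|` and `|f(v) - f(v+a)| ≤ μ|a|`. Conjugation by `e^f` leaves the diagonal part of
`H` alone and changes the hopping by an operator of norm at most `b(μ) ≤ η/2`. Hence `e^f` can be
moved through a resolvent at distance `b` or `3b` from the real axis at the cost of a factor `3` or
`9/7` (`norm_expOperator_resolvent_le`). One factor `e^{-f(x)}` is left over, and the constants
multiply to `108/7 < 18`.

Spectral measures and resolvents are both read off from the continuous functional calculus of the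
Cayley transform `V`. The two agree once the point `1` of the circle, the image of `∞`, is known to
have measure zero. -/

open MeasureTheory Filter Topology

noncomputable section

/-! ### Spectral measures of the Cayley transform on the unit circle -/

namespace SelfAdjointCalculus

variable {E : Type*} [NormedAddCommGroup E] [InnerProductSpace ℂ E] [CompleteSpace E]
  {H : E →ₗ.[ℂ] E} (hH : IsSelfAdjoint H)

/-- The Riesz-Markov measure of `f ↦ ⟨ψ, f(V) ψ⟩`, where `V` is the Cayley transform of `H`. -/
def circleMeasure (ψ : E) : Measure ℂ := RealRMK.rieszMeasure (cayleyFunctional H hH ψ)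

theorem cayleyFunctional_apply (ψ : E) (f : C_c(ℂ, ℝ)) :
    cayleyFunctional H hH ψ f = (inner ℂ ψ (cfc (fun z => (f z : ℂ)) (cayley H hH) ψ)).re := rfl

theorem spectrum_cayley_subset : spectrum ℂ (cayley H hH) ⊆ Metric.sphere 0 1 :=
  spectrum.subset_circle_of_unitary (cayley_mem_unitary H hH)

instance isStarNormal_cayley : IsStarNormal (cayley H hH) :=
  isStarNormal_of_mem_unitary (cayley_mem_unitary H hH)

theorem integral_circleMeasure_compactlySupported (ψ : E) (f : C_c(ℂ, ℝ)) :
    ∫ z, f z ∂circleMeasure hH ψ =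
      (inner ℂ ψ (cfc (fun z => (f z : ℂ)) (cayley H hH) ψ)).re := by
  rw [circleMeasure, RealRMK.integral_rieszMeasure, cayleyFunctional_apply]

/-- A continuous compactly supported function with the same values as `g` on the ball of radius
`r`, nonnegative if `g` is. -/
theorem exists_cutoff {g : ℂ → ℝ} (hg : Continuous g) (r : ℝ) :
    ∃ f : C_c(ℂ, ℝ), (∀ z, ‖z‖ ≤ r → f z = g z) ∧ ∀ z, 0 ≤ g z → 0 ≤ f z := by
  obtain ⟨χ, h1, -, h3, h4⟩ := exists_continuous_one_zero_of_isCompact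
    (isCompact_closedBall (0 : ℂ) r) (isClosed_empty (X := ℂ)) (by simp)
  refine ⟨⟨⟨fun z => χ z * g z, by fun_prop⟩, h3.mul_right⟩, fun z hz => ?_, fun z hz => ?_⟩
  · have := h1 (show z ∈ Metric.closedBall 0 r by simpa using hz)
    simp at this
    simp [this]
  · exact mul_nonneg (h4 z).1 hz

instance isFiniteMeasureOnCompacts_circleMeasure (ψ : E) :
    IsFiniteMeasureOnCompacts (circleMeasure hH ψ) := by
  unfold circleMeasure; infer_instance

theorem integrable_circleMeasure_compactlySupported (ψ : E) (f : C_c(ℂ, ℝ)) :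
    Integrable f (circleMeasure hH ψ) :=
  f.continuous.integrable_of_hasCompactSupport f.hasCompactSupport

theorem cfc_congr_sphere {f g : ℂ → ℂ} (h : ∀ z, ‖z‖ = 1 → f z = g z) :
    cfc f (cayley H hH) = cfc g (cayley H hH) :=
  cfc_congr fun z hz => h z (by simpa using spectrum_cayley_subset hH hz)

/-- The function `(‖z‖ - 1)²` vanishes on the spectrum of a unitary, so its integral is zero. It is
not compactly supported, hence the cutoffs on balls of radius `n + 1`. -/
theorem ae_norm_eq_one (ψ : E) : ∀ᵐ z ∂circleMeasure hH ψ, ‖z‖ = 1 := by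
  have key : ∀ n : ℕ, ∀ᵐ z ∂circleMeasure hH ψ, ‖z‖ ≤ n + 1 → ‖z‖ = 1 := by
    intro n
    obtain ⟨f, hf1, hf2⟩ := exists_cutoff (g := fun z => (‖z‖ - 1) ^ 2) (by fun_prop) (n + 1)
    have h0 : ∫ z, f z ∂circleMeasure hH ψ = 0 := by
      rw [integral_circleMeasure_compactlySupported,
        cfc_congr_sphere hH (g := fun _ => 0) fun z hz => by
          rw [hf1 z (by rw [hz]; linarith [n.cast_nonneg (α := ℝ)]), hz]; simp]
      simp
    rw [integral_eq_zero_iff_of_nonneg (fun z => hf2 z (sq_nonneg _))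
      (integrable_circleMeasure_compactlySupported hH ψ f)] at h0
    filter_upwards [h0] with z hz hzn
    rw [hf1 z hzn] at hz
    have : ‖z‖ - 1 = 0 := by simpa using hz
    linarith
  filter_upwards [ae_all_iff.2 key] with z hz
  obtain ⟨n, hn⟩ := exists_nat_ge ‖z‖
  exact hz n (by linarith)

instance isFiniteMeasure_circleMeasure (ψ : E) : IsFiniteMeasure (circleMeasure hH ψ) := by
  refine ⟨?_⟩
  have h1 : circleMeasure hH ψ Set.univ = circleMeasure hH ψ (Metric.sphere 0 1) := by
    refine measure_congr ?_
    filter_upwards [ae_norm_eq_one hH ψ] with z hz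
    have : z ∈ Metric.sphere (0 : ℂ) 1 := by simpa using hz
    exact propext ⟨fun _ => this, fun _ => trivial⟩
  rw [h1]
  exact (isCompact_sphere _ _).measure_lt_top

theorem integral_circleMeasure_real (ψ : E) {g : ℂ → ℝ} (hg : Continuous g) :
    ((∫ z, g z ∂circleMeasure hH ψ : ℝ) : ℂ) =
      inner ℂ ψ (cfc (fun z => (g z : ℂ)) (cayley H hH) ψ) := by
  obtain ⟨f, hf1, -⟩ := exists_cutoff hg 1
  have h1 : ∫ z, g z ∂circleMeasure hH ψ = ∫ z, f z ∂circleMeasure hH ψ := by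
    refine integral_congr_ae ?_
    filter_upwards [ae_norm_eq_one hH ψ] with z hz
    rw [hf1 z hz.le]
  rw [h1, integral_circleMeasure_compactlySupported,
    cfc_congr_sphere hH (g := fun z => (g z : ℂ)) fun z hz => by rw [hf1 z hz.le]]
  -- A real symbol gives a self-adjoint operator, so the real part in the functional discards
  -- nothing.
  have hsa : IsSelfAdjoint (cfc (fun z => (g z : ℂ)) (cayley H hH)) := by
    rw [isSelfAdjoint_iff, ← cfc_star]
    simp
  have hsym := (ContinuousLinearMap.isSelfAdjoint_iff_isSymmetric.1 hsa)
  have := hsym.coe_re_inner_self_apply ψ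
  simpa using this

theorem integral_circleMeasure_of_continuous (ψ : E) {g : ℂ → ℂ} (hg : Continuous g) :
    ∫ z, g z ∂circleMeasure hH ψ = inner ℂ ψ (cfc g (cayley H hH) ψ) := by
  have hint : ∀ k : ℂ → ℝ, Continuous k →
      Integrable (fun z => (k z : ℂ)) (circleMeasure hH ψ) := by
    intro k hk
    have : Integrable (fun z => (k z : ℂ)) ((circleMeasure hH ψ).restrict (Metric.sphere 0 1)) :=
      (Continuous.continuousOn (by fun_prop)).integrableOn_compact (isCompact_sphere _ _)
    rwa [Measure.restrict_eq_self_of_ae_mem] at this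
    filter_upwards [ae_norm_eq_one hH ψ] with z hz
    simpa using hz
  obtain ⟨a, ha⟩ : ∃ a : ℂ → ℝ, a = fun z => (g z).re := ⟨_, rfl⟩
  obtain ⟨b, hb⟩ : ∃ b : ℂ → ℝ, b = fun z => (g z).im := ⟨_, rfl⟩
  have hre : Continuous a := by rw [ha]; fun_prop
  have him : Continuous b := by rw [hb]; fun_prop
  have hd : g = fun z => (a z : ℂ) + Complex.I * (b z : ℂ) := by
    ext z
    rw [ha, hb, mul_comm, Complex.re_add_im]
  rw [hd, integral_add (hint _ hre) ((hint _ him).const_mul _), integral_const_mul,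
    integral_complex_ofReal, integral_complex_ofReal, integral_circleMeasure_real hH ψ hre,
    integral_circleMeasure_real hH ψ him, cfc_add (cayley H hH) (fun z => (a z : ℂ))
      (fun z => Complex.I * (b z : ℂ)) (by fun_prop) (by fun_prop),
    cfc_const_mul Complex.I (fun z => (b z : ℂ)) (cayley H hH) (by fun_prop)]
  rw [add_apply, inner_add_right, smul_apply,
    inner_smul_right]

/-- Resolvent symbols have poles off the circle, so continuity is only available there; Tietze
extension reduces to a globally continuous symbol. -/
theorem integral_circleMeasure (ψ : E) {g : ℂ → ℂ} (hg : ContinuousOn g (Metric.sphere 0 1)) :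
    ∫ z, g z ∂circleMeasure hH ψ = inner ℂ ψ (cfc g (cayley H hH) ψ) := by
  obtain ⟨k, hk⟩ := ContinuousMap.exists_restrict_eq (Metric.isClosed_sphere (x := (0 : ℂ)) (ε := 1))
    ⟨_, hg.domRestrict⟩
  have hk' : ∀ z, ‖z‖ = 1 → g z = k z := by
    intro z hz
    have := congrArg (fun F => F ⟨z, by simpa using hz⟩) hk
    simpa using this.symm
  rw [cfc_congr_sphere hH hk', ← integral_circleMeasure_of_continuous hH ψ k.continuous]
  refine integral_congr_ae ?_
  filter_upwards [ae_norm_eq_one hH ψ] with z hz using hk' z hz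

/-- The domain of `H` is the range of `1 - V`. -/
theorem one_sub_cayley_apply (χ : E) :
    ∃ h : χ - cayley H hH χ ∈ H.domain,
      H ⟨χ - cayley H hH χ, h⟩ = Complex.I • (χ + cayley H hH χ) := by
  obtain ⟨⟨⟨ψ, η⟩, hg⟩, hψ⟩ := (shift_bijective hH (Or.inl rfl)).2 χ
  obtain ⟨a, rfl, rfl⟩ := H.mem_graph_iff.1 hg
  rw [shift_apply] at hψ
  dsimp only at hψ
  have h1 := cayley_apply H hH a
  rw [hψ] at h1
  have h2 : χ - cayley H hH χ = ((2 * Complex.I) • a : H.domain) := by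
    rw [h1, ← hψ, H.domain.coe_smul, mul_smul, two_smul]
    abel
  have h3 : χ + cayley H hH χ = (2 : ℂ) • H a := by
    rw [h1, ← hψ, two_smul]
    abel
  refine ⟨h2 ▸ Submodule.coe_mem _, ?_⟩
  rw [h3]
  have : (⟨χ - cayley H hH χ, h2 ▸ Submodule.coe_mem _⟩ : H.domain) = (2 * Complex.I) • a :=
    Subtype.ext h2
  rw [this, H.map_smul, smul_smul, mul_comm]

theorem exists_one_sub_cayley (ψ : H.domain) : ∃ χ : E, (ψ : E) = χ - cayley H hH χ := by
  -- `V` sends `Hψ + iψ` to `Hψ - iψ`, and the difference of these is `2iψ`.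
  refine ⟨(2 * Complex.I)⁻¹ • (H ψ + Complex.I • (ψ : E)), ?_⟩
  rw [map_smul, cayley_apply, ← smul_sub]
  have : H ψ + Complex.I • (ψ : E) - (H ψ - Complex.I • (ψ : E)) = (2 * Complex.I) • (ψ : E) := by
    rw [mul_smul, two_smul]; abel
  rw [this, smul_smul, inv_mul_cancel₀ (by simp), one_smul]

end SelfAdjointCalculus

/-! ### No mass at infinity, and transport to the real line -/

namespace SelfAdjointCalculus

variable {E : Type*} [NormedAddCommGroup E] [InnerProductSpace ℂ E] [CompleteSpace E]
  {H : E →ₗ.[ℂ] E} (hH : IsSelfAdjoint H)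

/-- A tent function of height one and slope `n` around the point `1`. -/
def tent (n : ℕ) (w : ℂ) : ℝ := max 0 (1 - n * ‖w - 1‖)

theorem continuous_tent (n : ℕ) : Continuous (tent n) := by unfold tent; fun_prop

theorem tent_nonneg (n : ℕ) (w : ℂ) : 0 ≤ tent n w := le_max_left _ _

theorem tent_le_one (n : ℕ) (w : ℂ) : tent n w ≤ 1 :=
  max_le zero_le_one (by have := mul_nonneg n.cast_nonneg (norm_nonneg (w - 1)); linarith)

theorem tent_mul_le {n : ℕ} (hn : 0 < n) (w : ℂ) : tent n w * ‖1 - w‖ ≤ 1 / n := by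
  rw [norm_sub_rev, tent]
  have hn' : (0 : ℝ) < n := by exact_mod_cast hn
  rcases le_total (1 - n * ‖w - 1‖) 0 with h | h
  · rw [max_eq_left h]; simp
  · rw [max_eq_right h, le_div_iff₀ hn']
    nlinarith [norm_nonneg (w - 1), sq_nonneg (n * ‖w - 1‖)]

/-- The tents shrink to the indicator of `{1}`, while `1 - w` vanishes at `1`; so the tent operators
tend to zero on the range of `1 - V`. -/
theorem cfc_tent_apply_one_sub_le {n : ℕ} (hn : 0 < n) (χ : E) :
    ‖cfc (fun z => (tent n z : ℂ)) (cayley H hH) (χ - cayley H hH χ)‖ ≤ 1 / n * ‖χ‖ := by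
  have hc := continuous_tent n
  have h1 : cfc (fun z => (tent n z : ℂ)) (cayley H hH) (χ - cayley H hH χ) =
      cfc (fun z => (tent n z : ℂ) * (1 - z)) (cayley H hH) χ := by
    rw [cfc_mul (fun z => (tent n z : ℂ)) (fun z => 1 - z) (cayley H hH) (by fun_prop)
      (by fun_prop), cfc_sub (fun _ => 1) (fun z => z) (cayley H hH) (by fun_prop) (by fun_prop),
      cfc_const_one ℂ (cayley H hH), cfc_id' ℂ (cayley H hH)]
    simp
  rw [h1]
  refine (ContinuousLinearMap.le_opNorm _ _).trans ?_
  gcongr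
  refine norm_cfc_le (by positivity) fun w _ => ?_
  rw [norm_mul, Complex.norm_real, Real.norm_of_nonneg (tent_nonneg _ _)]
  exact tent_mul_le hn w

theorem norm_cfc_tent_le (n : ℕ) : ‖cfc (fun z => (tent n z : ℂ)) (cayley H hH)‖ ≤ 1 :=
  norm_cfc_le zero_le_one fun w _ => by
    rw [Complex.norm_real, Real.norm_of_nonneg (tent_nonneg _ _)]
    exact tent_le_one n w

theorem circleMeasure_real_singleton_le (ψ : E) (n : ℕ) :
    (circleMeasure hH ψ).real {1} ≤
      ‖ψ‖ * ‖cfc (fun z => (tent n z : ℂ)) (cayley H hH) ψ‖ := by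
  have hc := continuous_tent n
  have h1 : (circleMeasure hH ψ).real {1} ≤ ∫ z, tent n z ∂circleMeasure hH ψ := by
    rw [← integral_indicator_one (measurableSet_singleton _)]
    refine integral_mono ((integrable_const 1).indicator (measurableSet_singleton _)) ?_ ?_
    · refine Integrable.of_bound hc.aestronglyMeasurable 1 (ae_of_all _ fun z => ?_)
      rw [Real.norm_of_nonneg (tent_nonneg _ _)]
      exact tent_le_one n z
    · intro z
      by_cases hz : z = 1
      · subst hz; simp [tent]
      · simp [hz, tent_nonneg]
  refine h1.trans ?_
  have h2 := integral_circleMeasure_real hH ψ hc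
  have h3 : ∫ z, tent n z ∂circleMeasure hH ψ ≤
      ‖((∫ z, tent n z ∂circleMeasure hH ψ : ℝ) : ℂ)‖ := by
    rw [Complex.norm_real]; exact Real.le_norm_self _
  refine h3.trans ?_
  rw [h2]
  exact norm_inner_le_norm _ _

/-- The point `1`, which corresponds to `∞` on the real line, carries no mass. -/
theorem circleMeasure_singleton_one (ψ : E) : circleMeasure hH ψ {1} = 0 := by
  rw [← measureReal_eq_zero_iff]
  refine le_antisymm (le_of_forall_pos_le_add fun ε hε => ?_) measureReal_nonneg
  rw [zero_add]
  have hψ : 0 < ‖ψ‖ + 1 := by positivity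
  -- The range of `1 - V` is the domain of `H`, hence dense. As the tent operators are uniformly
  -- bounded, smallness on this range passes to every `ψ`.
  obtain ⟨φ, hφ, hd⟩ := Metric.mem_closure_iff.1 (hH.dense_domain ψ) (ε / (2 * (‖ψ‖ + 1)))
    (by positivity)
  obtain ⟨χ, hχ⟩ := exists_one_sub_cayley hH ⟨φ, hφ⟩
  dsimp only at hχ
  obtain ⟨n, hn⟩ := exists_nat_gt (2 * (‖ψ‖ + 1) * (‖χ‖ + 1) / ε)
  have hn0 : (0 : ℝ) < n := lt_of_le_of_lt (by positivity) hn
  have hnn : 0 < n := by exact_mod_cast hn0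
  refine (circleMeasure_real_singleton_le hH ψ n).trans ?_
  set T := cfc (fun z => (tent n z : ℂ)) (cayley H hH)
  have h1 : ‖T ψ‖ ≤ 1 / n * ‖χ‖ + ε / (2 * (‖ψ‖ + 1)) := by
    have : T ψ = T φ + T (ψ - φ) := by rw [← map_add]; congr 1; abel
    rw [this]
    refine (norm_add_le _ _).trans (add_le_add ?_ ?_)
    · rw [hχ]; exact cfc_tent_apply_one_sub_le hH hnn χ
    · refine (T.le_opNorm _).trans ?_
      rw [dist_eq_norm] at hd
      have := norm_cfc_tent_le hH n
      calc ‖T‖ * ‖ψ - φ‖ ≤ 1 * ‖ψ - φ‖ := by gcongr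
        _ ≤ _ := by linarith
  have h2 : 1 / n * ‖χ‖ ≤ ε / (2 * (‖ψ‖ + 1)) := by
    rw [div_lt_iff₀ hε] at hn
    rw [div_mul_eq_mul_div, div_le_div_iff₀ hn0 (by positivity)]
    nlinarith [norm_nonneg χ]
  calc ‖ψ‖ * ‖T ψ‖ ≤ (‖ψ‖ + 1) * (2 * (ε / (2 * (‖ψ‖ + 1)))) := by
        gcongr
        · linarith
        · linarith
    _ = ε := by field_simp

theorem measurable_cayleyInv : Measurable cayleyInv := by
  unfold cayleyInv; fun_prop

instance isFiniteMeasure_spectralMeasure (ψ : E) : IsFiniteMeasure (spectralMeasure H hH ψ) := by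
  change IsFiniteMeasure ((circleMeasure hH ψ).map cayleyInv)
  infer_instance

/-- Integrals against the spectral measure of a function whose transport to the unit circle
extends continuously. -/
theorem integral_spectralMeasure (ψ : E) {G : ℝ → ℂ} {g : ℂ → ℂ}
    (hG : AEStronglyMeasurable G (spectralMeasure H hH ψ))
    (hg : ContinuousOn g (Metric.sphere 0 1))
    (h : ∀ w, ‖w‖ = 1 → w ≠ 1 → G (cayleyInv w) = g w) :
    ∫ t, G t ∂spectralMeasure H hH ψ = inner ℂ ψ (cfc g (cayley H hH) ψ) := by
  rw [← integral_circleMeasure hH ψ hg, spectralMeasure, ← circleMeasure] at *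
  rw [integral_map measurable_cayleyInv.aemeasurable hG]
  refine integral_congr_ae ?_
  have h1 : ∀ᵐ w ∂circleMeasure hH ψ, w ≠ 1 := by
    rw [ae_iff]; simpa using circleMeasure_singleton_one hH ψ
  filter_upwards [ae_norm_eq_one hH ψ, h1] with w hw hw1 using h w hw hw1

theorem measureReal_spectralMeasure_univ (ψ : E) :
    (spectralMeasure H hH ψ).real Set.univ = ‖ψ‖ ^ 2 := by
  have := integral_spectralMeasure hH ψ (G := fun _ => 1) (g := fun _ => 1)
    aestronglyMeasurable_const continuousOn_const (fun _ _ _ => rfl)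
  rw [cfc_const_one ℂ (cayley H hH)] at this
  simp [inner_self_eq_norm_sq_to_K] at this
  exact_mod_cast this

theorem polarization {E : Type*} [NormedAddCommGroup E] [InnerProductSpace ℂ E]
    (T : E →L[ℂ] E) (φ ψ : E) :
    (1 / 4 : ℂ) * (inner ℂ (φ + ψ) (T (φ + ψ)) - inner ℂ (φ - ψ) (T (φ - ψ))
      - Complex.I * inner ℂ (φ + Complex.I • ψ) (T (φ + Complex.I • ψ))
      + Complex.I * inner ℂ (φ - Complex.I • ψ) (T (φ - Complex.I • ψ))) = inner ℂ φ (T ψ) := by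
  simp only [map_add, map_sub, map_smul, inner_add_left, inner_add_right, inner_sub_left,
    inner_sub_right, inner_smul_left, inner_smul_right, Complex.conj_I]
  linear_combination (1 / 2) * (inner ℂ ψ (T φ) - inner ℂ φ (T ψ)) * Complex.I_sq

/-- The matrix element is a bounded functional of the bounded function `F`. -/
theorem norm_matrixElement_le {F : ℝ → ℂ} {C : ℝ} (hF : ∀ t, ‖F t‖ ≤ C) (φ ψ : E) :
    ‖matrixElement H hH F φ ψ‖ ≤ C * (‖φ‖ ^ 2 + ‖ψ‖ ^ 2) := by
  have h : ∀ χ : E, ‖∫ t, F t ∂spectralMeasure H hH χ‖ ≤ C * ‖χ‖ ^ 2 := fun χ => by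
    rw [← measureReal_spectralMeasure_univ hH χ]
    exact norm_integral_le_of_norm_le_const (ae_of_all _ hF)
  -- The four polarized measures have total masses summing, by two parallelogram laws, to `4(‖φ‖² +
  -- ‖ψ‖²)`; the prefactor `1/4` cancels the `4`.
  have p1 := parallelogram_law_with_norm ℂ φ ψ
  have p2 := parallelogram_law_with_norm ℂ φ (Complex.I • ψ)
  rw [norm_smul, Complex.norm_I, one_mul] at p2
  rw [matrixElement]
  have h1 := h (φ + ψ)
  have h2 := h (φ - ψ)
  have h3 := h (φ + Complex.I • ψ)
  have h4 := h (φ - Complex.I • ψ)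
  rw [norm_mul]
  refine (mul_le_mul_of_nonneg_left ((norm_add_le _ _).trans (add_le_add ((norm_sub_le _ _).trans
    (add_le_add (norm_sub_le _ _) le_rfl)) le_rfl)) (norm_nonneg _)).trans ?_
  simp only [norm_mul, Complex.norm_I, one_mul]
  norm_num
  linear_combination (1/4) * h1 + (1/4) * h2 + (1/4) * h3 + (1/4) * h4 + (C/4) * p1 + (C/4) * p2

/-! ### Resolvents as functions of the Cayley transform -/

/-- The symbol `(t - ζ)⁻¹` of the resolvent in the variable `w = (t - i)/(t + i)`. -/
def resolventSymbol (ζ w : ℂ) : ℂ := (1 - w) / ((Complex.I - ζ) + (Complex.I + ζ) * w)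

/-- A zero on the circle would make `ζ` equidistant from `i` and `-i`, that is, real. -/
theorem resolventSymbol_denom_ne_zero {ζ w : ℂ} (hζ : ζ.im ≠ 0) (hw : ‖w‖ = 1) :
    (Complex.I - ζ) + (Complex.I + ζ) * w ≠ 0 := by
  intro h
  have h1 : ‖Complex.I - ζ‖ = ‖Complex.I + ζ‖ := by
    rw [eq_neg_of_add_eq_zero_left h, norm_neg, norm_mul, hw, mul_one]
  have h2 : Complex.normSq (Complex.I - ζ) = Complex.normSq (Complex.I + ζ) := by
    rw [Complex.normSq_eq_norm_sq, Complex.normSq_eq_norm_sq, h1]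
  simp [Complex.normSq_apply] at h2
  apply hζ
  linarith

theorem continuousOn_resolventSymbol {ζ : ℂ} (hζ : ζ.im ≠ 0) :
    ContinuousOn (resolventSymbol ζ) (Metric.sphere 0 1) := by
  unfold resolventSymbol
  exact ContinuousOn.div (by fun_prop) (by fun_prop) fun w hw =>
    resolventSymbol_denom_ne_zero hζ (by simpa using hw)

theorem cayleyInv_coe {w : ℂ} (hw : ‖w‖ = 1) (hw1 : w ≠ 1) :
    (cayleyInv w : ℂ) = Complex.I * (1 + w) / (1 - w) := by
  rw [cayleyInv]
  refine Complex.conj_eq_iff_re.1 ?_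
  have h0 : w ≠ 0 := by rintro rfl; simp at hw
  have hc : (starRingEnd ℂ) w = w⁻¹ := (Complex.inv_eq_conj hw).symm
  have h1 : 1 - w ≠ 0 := sub_ne_zero.2 hw1.symm
  have h2 : 1 - w⁻¹ ≠ 0 := by
    rw [sub_ne_zero]; intro h; exact hw1 (by simpa using h.symm)
  have h3 : w - 1 ≠ 0 := sub_ne_zero.2 hw1
  simp only [map_div₀, map_mul, map_add, map_sub, map_one, Complex.conj_I, hc]
  rw [div_eq_div_iff h2 h1]
  field_simp
  ring

theorem resolventSymbol_eq {ζ w : ℂ} (hw : ‖w‖ = 1) (hw1 : w ≠ 1) :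
    ((cayleyInv w : ℂ) - ζ)⁻¹ = resolventSymbol ζ w := by
  have h1 : 1 - w ≠ 0 := sub_ne_zero.2 hw1.symm
  rw [cayleyInv_coe hw hw1, resolventSymbol, div_sub' h1, inv_div]
  congr 1
  ring

theorem resolventSymbol_one (ζ : ℂ) : resolventSymbol ζ 1 = 0 := by simp [resolventSymbol]

theorem norm_inv_ofReal_sub_le {ζ : ℂ} (hζ : ζ.im ≠ 0) (t : ℝ) : ‖((t : ℂ) - ζ)⁻¹‖ ≤ |ζ.im|⁻¹ := by
  rw [norm_inv]
  refine inv_anti₀ (abs_pos.2 hζ) ?_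
  simpa using Complex.abs_im_le_norm ((t : ℂ) - ζ)

theorem norm_resolventSymbol_le {ζ w : ℂ} (hζ : ζ.im ≠ 0) (hw : ‖w‖ = 1) :
    ‖resolventSymbol ζ w‖ ≤ |ζ.im|⁻¹ := by
  by_cases hw1 : w = 1
  · subst hw1; rw [resolventSymbol_one, norm_zero]; positivity
  · rw [← resolventSymbol_eq hw hw1]; exact norm_inv_ofReal_sub_le hζ _

/-- The resolvent `(H - ζ)⁻¹` at a point off the real line. -/
def resolvent (ζ : ℂ) : E →L[ℂ] E := cfc (resolventSymbol ζ) (cayley H hH)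

variable {ζ : ℂ}

theorem continuousOn_spectrum {g : ℂ → ℂ} (hg : ContinuousOn g (Metric.sphere 0 1)) :
    ContinuousOn g (spectrum ℂ (cayley H hH)) := hg.mono (spectrum_cayley_subset hH)

theorem norm_resolvent_le (hζ : ζ.im ≠ 0) : ‖resolvent hH ζ‖ ≤ |ζ.im|⁻¹ :=
  norm_cfc_le (by positivity) fun w hw =>
    norm_resolventSymbol_le hζ (by simpa using spectrum_cayley_subset hH hw)

theorem star_resolventSymbol {w : ℂ} (hw : ‖w‖ = 1) :
    star (resolventSymbol ζ w) = resolventSymbol (star ζ) w := by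
  by_cases hw1 : w = 1
  · subst hw1; simp [resolventSymbol_one]
  · rw [← resolventSymbol_eq hw hw1, ← resolventSymbol_eq hw hw1]
    simp

theorem adjoint_resolvent : (resolvent hH ζ).adjoint = resolvent hH (star ζ) := by
  rw [← ContinuousLinearMap.star_eq_adjoint, resolvent, ← cfc_star, resolvent]
  exact cfc_congr_sphere hH fun w hw => star_resolventSymbol hw

theorem inner_resolvent_left (φ ψ : E) :
    inner ℂ (resolvent hH ζ φ) ψ = inner ℂ φ (resolvent hH (star ζ) ψ) := by
  rw [← adjoint_resolvent, ContinuousLinearMap.adjoint_inner_right]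

theorem cfc_resolvent_denom (ζ : ℂ) (χ : E) :
    cfc (fun w => (Complex.I - ζ) + (Complex.I + ζ) * w) (cayley H hH) χ =
      Complex.I • (χ + cayley H hH χ) - ζ • (χ - cayley H hH χ) := by
  rw [cfc_add (cayley H hH) (fun _ => Complex.I - ζ) (fun w => (Complex.I + ζ) * w) (by fun_prop)
    (by fun_prop), cfc_const_mul (Complex.I + ζ) (fun w => w) (cayley H hH) (by fun_prop),
    cfc_id' ℂ (cayley H hH), cfc_const (Complex.I - ζ) (cayley H hH)]
  simp [Algebra.algebraMap_eq_smul_one]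
  module

/-- On `χ - Vχ` the operator `H` acts as `i(χ + Vχ)`, so the argument is `(H - ζ)(χ - Vχ)`: this is
the left-inverse property in terms of `V`. -/
theorem resolvent_cfc_denom (hζ : ζ.im ≠ 0) (χ : E) :
    resolvent hH ζ (Complex.I • (χ + cayley H hH χ) - ζ • (χ - cayley H hH χ)) =
      χ - cayley H hH χ := by
  rw [← cfc_resolvent_denom, resolvent, ← mul_apply_eq_comp, ← cfc_mul _ _ _
    (continuousOn_spectrum hH (continuousOn_resolventSymbol hζ)) (by fun_prop),
    cfc_congr_sphere hH (g := fun w => 1 - w) fun w hw => by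
      rw [resolventSymbol, div_mul_cancel₀ _ (resolventSymbol_denom_ne_zero hζ hw)],
    cfc_sub (fun _ => 1) (fun z => z) (cayley H hH) (by fun_prop) (by fun_prop),
    cfc_const_one ℂ (cayley H hH), cfc_id' ℂ (cayley H hH)]
  simp

theorem resolvent_sub_smul (hζ : ζ.im ≠ 0) (ψ : H.domain) :
    resolvent hH ζ (H ψ - ζ • (ψ : E)) = ψ := by
  obtain ⟨χ, hχ⟩ := exists_one_sub_cayley hH ψ
  obtain ⟨h, h'⟩ := one_sub_cayley_apply hH χ
  obtain rfl : ψ = ⟨χ - cayley H hH χ, h⟩ := Subtype.ext hχ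
  rw [h']
  exact resolvent_cfc_denom hH hζ χ

theorem resolvent_mem_domain (hζ : ζ.im ≠ 0) (φ : E) :
    ∃ h : resolvent hH ζ φ ∈ H.domain, H ⟨resolvent hH ζ φ, h⟩ = φ + ζ • resolvent hH ζ φ := by
  have hden : ∀ w ∈ Metric.sphere (0 : ℂ) 1, (Complex.I - ζ) + (Complex.I + ζ) * w ≠ 0 :=
    fun w hw => resolventSymbol_denom_ne_zero hζ (by simpa using hw)
  have hinv : ContinuousOn (fun w => ((Complex.I - ζ) + (Complex.I + ζ) * w)⁻¹)
      (Metric.sphere (0 : ℂ) 1) := ContinuousOn.inv₀ (by fun_prop) hden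
  obtain ⟨χ, hχ⟩ : ∃ χ, Complex.I • (χ + cayley H hH χ) - ζ • (χ - cayley H hH χ) = φ := by
    refine ⟨cfc (fun w => ((Complex.I - ζ) + (Complex.I + ζ) * w)⁻¹) (cayley H hH) φ, ?_⟩
    rw [← cfc_resolvent_denom, ← mul_apply_eq_comp, ← cfc_mul _ _ _ (by fun_prop)
      (continuousOn_spectrum hH hinv), cfc_congr_sphere hH (g := fun _ => 1) fun w hw =>
      mul_inv_cancel₀ (hden w (by simpa using hw)), cfc_const_one ℂ (cayley H hH)]
    rfl
  have hR := resolvent_cfc_denom hH hζ χ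
  rw [hχ] at hR
  obtain ⟨h, h'⟩ := one_sub_cayley_apply hH χ
  refine ⟨hR ▸ h, ?_⟩
  have : (⟨resolvent hH ζ φ, hR ▸ h⟩ : H.domain) = ⟨χ - cayley H hH χ, h⟩ := Subtype.ext hR
  rw [this, h', hR, ← hχ]
  abel

end SelfAdjointCalculus

/-! ### Cauchy's formula for bounded analytic functions on a strip -/

namespace LatticeHamiltonian

theorem integrable_inv_sq_add_sq {b : ℝ} (hb : 0 < b) :
    Integrable fun x : ℝ => (x ^ 2 + b ^ 2)⁻¹ := by
  have h : (fun x : ℝ => (x ^ 2 + b ^ 2)⁻¹) = fun x => (b ^ 2)⁻¹ * (1 + (x / b) ^ 2)⁻¹ := by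
    ext x; field_simp; ring
  rw [h]
  exact (integrable_inv_one_add_sq.comp_div hb.ne').const_mul _

theorem integral_inv_sq_add_sq {b : ℝ} (hb : 0 < b) :
    ∫ x : ℝ, (x ^ 2 + b ^ 2)⁻¹ = Real.pi / b := by
  have h : (fun x : ℝ => (x ^ 2 + b ^ 2)⁻¹) = fun x => (b ^ 2)⁻¹ * (1 + (x / b) ^ 2)⁻¹ := by
    ext x; field_simp; ring
  rw [h, integral_const_mul, Measure.integral_comp_div (fun x => (1 + x ^ 2)⁻¹),
    integral_univ_inv_one_add_sq, abs_of_pos hb, smul_eq_mul]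
  field_simp

/-- The kernel of the representation of `F` on the real line by its values on the lines
`Im z = ± b`. -/
def stripKernel (F : ℂ → ℂ) (b u t : ℝ) : ℂ :=
  (((u - t) ^ 2 + b ^ 2)⁻¹ : ℝ) *
    (F (u - b * Complex.I) * ((u - t : ℝ) - 3 * b * Complex.I)⁻¹
      - F (u + b * Complex.I) * ((u - t : ℝ) + 3 * b * Complex.I)⁻¹)

section

variable {F : ℂ → ℂ} {η b C : ℝ}

theorem isOpen_strip : IsOpen (strip η) :=
  isOpen_lt (by fun_prop) continuous_const

theorem norm_inv_ofReal_add_mul_I_le {c : ℝ} (hc : c ≠ 0) (x : ℝ) :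
    ‖((x : ℂ) + c * Complex.I)⁻¹‖ ≤ |c|⁻¹ := by
  rw [norm_inv]
  refine inv_anti₀ (abs_pos.2 hc) ?_
  simpa using Complex.abs_im_le_norm ((x : ℂ) + c * Complex.I)

theorem sub_mul_I_mem_strip (hb : 0 < b) (hbη : b < η) (u : ℝ) :
    (u : ℂ) - b * Complex.I ∈ strip η := by
  simp [strip, abs_of_pos hb, hbη]

theorem add_mul_I_mem_strip (hb : 0 < b) (hbη : b < η) (u : ℝ) :
    (u : ℂ) + b * Complex.I ∈ strip η := by
  simp [strip, abs_of_pos hb, hbη]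

theorem ofReal_add_mul_I_ne_zero {c : ℝ} (hc : c ≠ 0) (x : ℝ) : (x : ℂ) + c * Complex.I ≠ 0 := by
  intro h
  have := congrArg Complex.im h
  simp at this
  exact hc this

theorem norm_stripKernel_le (hb : 0 < b) (hbη : b < η) (hC : ∀ z ∈ strip η, ‖F z‖ ≤ C)
    (u t : ℝ) : ‖stripKernel F b u t‖ ≤ 2 * C / (3 * b) * ((u - t) ^ 2 + b ^ 2)⁻¹ := by
  have hC0 : 0 ≤ C := (norm_nonneg _).trans (hC _ (sub_mul_I_mem_strip hb hbη 0))
  have h1 := norm_inv_ofReal_add_mul_I_le (c := 3 * b) (by positivity) (u - t)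
  have h2 := norm_inv_ofReal_add_mul_I_le (c := -(3 * b)) (by simp [hb.ne']) (u - t)
  rw [abs_neg, abs_of_pos (by positivity)] at h2
  rw [abs_of_pos (by positivity)] at h1
  rw [stripKernel, norm_mul, Complex.norm_real, Real.norm_of_nonneg (by positivity), mul_comm]
  gcongr
  refine (norm_sub_le _ _).trans ?_
  rw [norm_mul, norm_mul]
  have h3 : (((u - t : ℝ) : ℂ) - 3 * b * Complex.I) =
      ((u - t : ℝ) : ℂ) + ((-(3 * b) : ℝ) : ℂ) * Complex.I := by push_cast; ring
  have h4 : (((u - t : ℝ) : ℂ) + 3 * b * Complex.I) =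
      ((u - t : ℝ) : ℂ) + ((3 * b : ℝ) : ℂ) * Complex.I := by push_cast; ring
  rw [h3, h4]
  calc _ ≤ C * (3 * b)⁻¹ + C * (3 * b)⁻¹ := by
        gcongr
        · exact hC _ (sub_mul_I_mem_strip hb hbη u)
        · exact hC _ (add_mul_I_mem_strip hb hbη u)
    _ = _ := by field_simp; ring

theorem continuous_stripKernel (hb : 0 < b) (hbη : b < η) (hF : ContinuousOn F (strip η)) :
    Continuous fun p : ℝ × ℝ => stripKernel F b p.1 p.2 := by
  have h1 : Continuous fun p : ℝ × ℝ => F (p.1 - b * Complex.I) :=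
    hF.comp_continuous (by fun_prop) fun p => sub_mul_I_mem_strip hb hbη p.1
  have h2 : Continuous fun p : ℝ × ℝ => F (p.1 + b * Complex.I) :=
    hF.comp_continuous (by fun_prop) fun p => add_mul_I_mem_strip hb hbη p.1
  have h3 : ∀ p : ℝ × ℝ, (((p.1 - p.2 : ℝ) : ℂ) - 3 * b * Complex.I) ≠ 0 := fun p => by
    have := ofReal_add_mul_I_ne_zero (c := -(3 * b)) (by simp [hb.ne']) (p.1 - p.2)
    intro h; apply this; rw [← h]; push_cast; ring
  have h4 : ∀ p : ℝ × ℝ, (((p.1 - p.2 : ℝ) : ℂ) + 3 * b * Complex.I) ≠ 0 := fun p => by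
    have := ofReal_add_mul_I_ne_zero (c := 3 * b) (by positivity) (p.1 - p.2)
    intro h; apply this; rw [← h]; push_cast; ring
  have h5 : ∀ p : ℝ × ℝ, (p.1 - p.2) ^ 2 + b ^ 2 ≠ 0 := fun p => by positivity
  unfold stripKernel
  refine (Complex.continuous_ofReal.comp (Continuous.inv₀ (by fun_prop) h5)).mul
    ((h1.mul (Continuous.inv₀ ?_ h3)).sub (h2.mul (Continuous.inv₀ ?_ h4)))
  · exact (Complex.continuous_ofReal.comp (by fun_prop)).sub continuous_const
  · exact (Complex.continuous_ofReal.comp (by fun_prop)).add continuous_const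

theorem integrable_stripKernel_left (hb : 0 < b) (hbη : b < η) (hF : ContinuousOn F (strip η))
    (hC : ∀ z ∈ strip η, ‖F z‖ ≤ C) (t : ℝ) : Integrable fun u => stripKernel F b u t := by
  have hc := (continuous_stripKernel hb hbη hF).comp (Continuous.prodMk_left t)
  refine Integrable.mono' (g := fun u => 2 * C / (3 * b) * ((u - t) ^ 2 + b ^ 2)⁻¹)
    (((integrable_inv_sq_add_sq hb).comp_sub_right t).const_mul _) hc.aestronglyMeasurable
    (ae_of_all _ fun u => norm_stripKernel_le hb hbη hC u t)

/-- Cauchy's formula at the origin for a bounded analytic function on the strip. -/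
theorem integral_stripKernel_zero (hb : 0 < b) (hbη : b < η) (hF : DifferentiableOn ℂ F (strip η))
    (hC : ∀ z ∈ strip η, ‖F z‖ ≤ C) :
    4 * b ^ 2 * ∫ u : ℝ, stripKernel F b u 0 = 2 * Real.pi * Complex.I * F 0 := by
  have hC0 : 0 ≤ C := (norm_nonneg _).trans (hC _ (sub_mul_I_mem_strip hb hbη 0))
  have hbC : (b : ℂ) ≠ 0 := by exact_mod_cast hb.ne'
  -- The extra factor is `1` at `0` and supplies decay. Its poles `± 2ib` lie outside `|Im z| ≤ b`
  -- and are chosen so that on `z = x ∓ ib` it contains `1/(x ± ib)`, which pairs with `1/z` to give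
  -- `1/(x² + b²)`, leaving `1/(x ∓ 3ib)`.
  set G : ℂ → ℂ := fun z => F z * (4 * b ^ 2 / (z ^ 2 + 4 * b ^ 2)) with hG
  set s : Set ℂ := strip η ∩ strip (2 * b) with hs
  have hden : ∀ z ∈ strip (2 * b), z ^ 2 + 4 * (b : ℂ) ^ 2 ≠ 0 := by
    intro z hz h
    have h1 : (z - 2 * b * Complex.I) * (z + 2 * b * Complex.I) = 0 := by
      linear_combination h - 4 * (b : ℂ) ^ 2 * Complex.I_sq
    have hz' : |z.im| < 2 * b := hz
    rcases mul_eq_zero.1 h1 with h2 | h2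
    · have := congrArg Complex.im h2
      simp at this
      rw [abs_lt] at hz'; linarith
    · have := congrArg Complex.im h2
      simp at this
      rw [abs_lt] at hz'; linarith
  have hGd : DifferentiableOn ℂ G s := by
    refine (hF.mono Set.inter_subset_left).mul (DifferentiableOn.div (by fun_prop) (by fun_prop) ?_)
    exact fun z hz => hden z hz.2
  have h0s : (0 : ℂ) ∈ s := by simp [hs, strip, hb, hb.trans hbη]
  have hso : IsOpen s := isOpen_strip.inter isOpen_strip
  -- Using `(G(z) - G(0))/z` removes the pole at `0`, so Cauchy's theorem on rectangles suffices.
  -- The residue reappears as the explicit integral of `2ib F(0)/(x² + b²)`.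
  have hD : DifferentiableOn ℂ (dslope G 0) s :=
    (Complex.differentiableOn_dslope (hso.mem_nhds h0s)).2 hGd
  have hmem : ∀ z : ℂ, |z.im| ≤ b → z ∈ s := fun z hz =>
    ⟨lt_of_le_of_lt hz hbη, lt_of_le_of_lt hz (by linarith)⟩
  have hGb : ∀ z : ℂ, |z.im| ≤ b → ‖G z‖ ≤ 2 * C := by
    intro z hz
    have h1 : 3 * b ^ 2 ≤ ‖z ^ 2 + 4 * (b : ℂ) ^ 2‖ := by
      refine le_trans ?_ (Complex.re_le_norm _)
      have : (z ^ 2 + 4 * (b : ℂ) ^ 2).re = z.re ^ 2 - z.im ^ 2 + 4 * b ^ 2 := by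
        rw [Complex.add_re]
        congr 1
        · simp [pow_two]
        · norm_cast
      rw [this]
      have := sq_le_sq' (abs_le.1 hz).1 (abs_le.1 hz).2
      nlinarith [sq_nonneg z.re]
    rw [hG]
    dsimp only
    rw [norm_mul, norm_div, mul_comm 2 C]
    refine mul_le_mul (hC z (hmem z hz).1) ?_ (by positivity) hC0
    have h2 : ‖(4 * (b : ℂ) ^ 2)‖ = 4 * b ^ 2 := by simp
    rw [h2, div_le_iff₀ (lt_of_lt_of_le (by positivity) h1)]
    nlinarith [sq_nonneg b]
  have hDb : ∀ z : ℂ, |z.im| ≤ b → z ≠ 0 → ‖dslope G 0 z‖ ≤ 4 * C / ‖z‖ := by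
    intro z hz hz0
    rw [dslope_of_ne _ hz0, slope_def_field, sub_zero, norm_div]
    gcongr
    refine (norm_sub_le _ _).trans ?_
    linarith [hGb z hz, hGb 0 (by simpa using hb.le)]
  set L : ℝ → ℂ := fun x => 4 * b ^ 2 * stripKernel F b x 0
    - F 0 * (2 * b * Complex.I) * ((x ^ 2 + b ^ 2)⁻¹ : ℝ) with hL
  have hi1 := (integrable_stripKernel_left hb hbη hF.continuousOn hC 0).const_mul (4 * (b : ℂ) ^ 2)
  have hi2 : Integrable fun x : ℝ =>
      F 0 * (2 * b * Complex.I) * (((x ^ 2 + b ^ 2)⁻¹ : ℝ) : ℂ) :=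
    (integrable_inv_sq_add_sq hb).ofReal.const_mul _
  have hLi : Integrable L := hi1.sub hi2
  have hline : ∀ x : ℝ, dslope G 0 (x + (-b : ℝ) * Complex.I) - dslope G 0 (x + b * Complex.I) =
      L x := by
    intro x
    have e1 := ofReal_add_mul_I_ne_zero (c := -b) (by simp [hb.ne']) x
    have e2 := ofReal_add_mul_I_ne_zero hb.ne' x
    have e3 := ofReal_add_mul_I_ne_zero (c := 3 * b) (by positivity) x
    have e4 := ofReal_add_mul_I_ne_zero (c := -(3 * b)) (by simp [hb.ne']) x
    push_cast at e1 e2 e3 e4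
    have f1 : ((x : ℂ) + -b * Complex.I) ^ 2 + 4 * b ^ 2 =
        (x + b * Complex.I) * (x + -(3 * b) * Complex.I) := by
      linear_combination (4 * (b : ℂ) ^ 2) * Complex.I_sq
    have f2 : ((x : ℂ) + b * Complex.I) ^ 2 + 4 * b ^ 2 =
        (x + -b * Complex.I) * (x + (3 * b) * Complex.I) := by
      linear_combination (4 * (b : ℂ) ^ 2) * Complex.I_sq
    have f3 : (x : ℂ) ^ 2 + b ^ 2 = (x + b * Complex.I) * (x + -b * Complex.I) := by
      linear_combination ((b : ℂ) ^ 2) * Complex.I_sq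
    have f4 : (x : ℂ) - 3 * b * Complex.I = x + -(3 * b) * Complex.I := by ring
    have f5 : (x : ℂ) - b * Complex.I = x + -b * Complex.I := by ring
    rw [dslope_of_ne _ (by push_cast; exact e1), dslope_of_ne _ e2, slope_def_field,
      slope_def_field, hL, hG]
    dsimp only
    rw [stripKernel]
    push_cast
    simp only [sub_zero]
    rw [f1, f2, f3, f4, f5]
    generalize F (x + -b * Complex.I) = F1
    generalize F (x + b * Complex.I) = F2
    have f6 : (0 : ℂ) ^ 2 + 4 * (b : ℂ) ^ 2 = 4 * b ^ 2 := by ring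
    have f7 : 2 * (b : ℂ) * Complex.I = (x + b * Complex.I) - (x + -b * Complex.I) := by ring
    rw [f6, div_self (by simpa using hbC), f7]
    generalize (x : ℂ) + b * Complex.I = p at *
    generalize (x : ℂ) + -b * Complex.I = q at *
    generalize (x : ℂ) + (3 * b) * Complex.I = r at *
    generalize (x : ℂ) + -(3 * b) * Complex.I = v at *
    clear * - e1 e2 e3 e4
    field_simp
    ring
  -- The vertical sides have fixed length `2b` and the integrand is `O(1/R)` there, so they vanish
  -- in the limit.
  have hvert : ∀ R : ℝ, 0 < R → ∀ r : ℝ, |r| = R →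
      ‖∫ y in (-b)..b, dslope G 0 ((r : ℂ) + y * Complex.I)‖ ≤ 4 * C / R * (2 * b) := by
    intro R hR r hr
    have := intervalIntegral.norm_integral_le_of_norm_le_const (a := -b) (b := b)
      (f := fun y : ℝ => dslope G 0 ((r : ℂ) + y * Complex.I)) (C := 4 * C / R) ?_
    · rwa [sub_neg_eq_add, abs_of_pos (by linarith), ← two_mul] at this
    · intro y hy
      rw [Set.uIoc_of_le (by linarith)] at hy
      have hre : R ≤ ‖(r : ℂ) + y * Complex.I‖ := by
        rw [← hr]; simpa using Complex.abs_re_le_norm ((r : ℂ) + y * Complex.I)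
      refine (hDb _ ?_ ?_).trans ?_
      · simpa [abs_le] using And.intro hy.1.le hy.2
      · intro h; rw [h, norm_zero] at hre; linarith
      · gcongr
  have hrect : ∀ R : ℝ, 0 < R → ‖∫ x in (-R)..R, L x‖ ≤ 16 * C * b / R := by
    intro R hR
    have hsub : (Set.uIcc (((-R : ℝ) : ℂ) + (-b : ℝ) * Complex.I).re
        ((R : ℂ) + b * Complex.I).re ×ℂ Set.uIcc (((-R : ℝ) : ℂ) + (-b : ℝ) * Complex.I).im
        ((R : ℂ) + b * Complex.I).im) ⊆ s := by
      rintro z ⟨-, hz⟩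
      refine hmem z (abs_le.2 ?_)
      simpa [Set.uIcc_of_le (show -b ≤ b by linarith)] using hz
    have key := Complex.integral_boundary_rect_eq_zero_of_differentiableOn (dslope G 0)
      (((-R : ℝ) : ℂ) + (-b : ℝ) * Complex.I) ((R : ℂ) + b * Complex.I) (hD.mono hsub)
    simp only [Complex.add_re, Complex.mul_re, Complex.ofReal_re, Complex.ofReal_im, Complex.I_re,
      Complex.I_im, Complex.add_im, Complex.mul_im, mul_zero, mul_one, add_zero, zero_add, sub_self] at key
    have hcont : ∀ c : ℝ, |c| ≤ b → IntervalIntegrable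
        (fun x : ℝ => dslope G 0 (x + c * Complex.I)) volume (-R) R := by
      intro c hc
      refine (hD.continuousOn.comp_continuous (by fun_prop) fun x => hmem _ ?_).intervalIntegrable
        _ _
      simpa using hc
    rw [← intervalIntegral.integral_sub (hcont (-b) (by simp [abs_of_pos hb]))
      (hcont b (by simp [abs_of_pos hb]))] at key
    simp only [hline] at key
    have v1 := hvert R hR R (abs_of_pos hR)
    have v2 := hvert R hR (-R) (by simp [abs_of_pos hR])
    have : ∫ x in (-R)..R, L x =
        Complex.I • (∫ y in (-b)..b, dslope G 0 (((-R : ℝ) : ℂ) + y * Complex.I))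
        - Complex.I • ∫ y in (-b)..b, dslope G 0 ((R : ℂ) + y * Complex.I) := by
      linear_combination key
    rw [this]
    refine (norm_sub_le _ _).trans ?_
    rw [norm_smul, norm_smul, Complex.norm_I, one_mul, one_mul]
    refine (add_le_add v2 v1).trans (le_of_eq ?_)
    field_simp
    ring
  have hlim : Tendsto (fun R : ℝ => ∫ x in (-R)..R, L x) atTop (𝓝 (∫ x, L x)) :=
    intervalIntegral_tendsto_integral hLi tendsto_neg_atTop_atBot tendsto_id
  have hlim0 : Tendsto (fun R : ℝ => ∫ x in (-R)..R, L x) atTop (𝓝 0) := by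
    refine squeeze_zero_norm' (a := fun R => 16 * C * b / R) ?_ ?_
    · filter_upwards [eventually_gt_atTop 0] with R hR using hrect R hR
    · exact tendsto_const_nhds.div_atTop tendsto_id
  have h0 := tendsto_nhds_unique hlim hlim0
  simp only [hL] at h0
  rw [integral_sub hi1 hi2, integral_const_mul, integral_const_mul,
      integral_complex_ofReal, integral_inv_sq_add_sq hb, sub_eq_zero] at h0
  rw [h0]
  push_cast
  field_simp

/-- A bounded analytic function on the strip is represented on the real line by its values on
the lines `Im z = ± b`. -/
theorem integral_stripKernel (hb : 0 < b) (hbη : b < η) (hF : DifferentiableOn ℂ F (strip η))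
    (hC : ∀ z ∈ strip η, ‖F z‖ ≤ C) (t : ℝ) :
    4 * b ^ 2 * ∫ u : ℝ, stripKernel F b u t = 2 * Real.pi * Complex.I * F t := by
  have hmaps : ∀ z ∈ strip η, z + (t : ℂ) ∈ strip η := fun z hz => by simpa [strip] using hz
  have h := integral_stripKernel_zero (F := fun z => F (z + t)) hb hbη
    (hF.comp (by fun_prop) hmaps) (fun z hz => hC _ (hmaps z hz))
  rw [zero_add] at h
  rw [← h, ← integral_add_right_eq_self (fun u => stripKernel F b u t) t]
  congr 2
  ext u
  simp only [stripKernel]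
  push_cast
  congr 3 <;> ring_nf

end

end LatticeHamiltonian

/-! ### The contour representation of the matrix elements of `F(H)` -/

namespace SelfAdjointCalculus

open LatticeHamiltonian

variable {E : Type*} [NormedAddCommGroup E] [InnerProductSpace ℂ E] [CompleteSpace E]
  {H : E →ₗ.[ℂ] E} (hH : IsSelfAdjoint H)

theorem continuous_inv_sub_sq_add_sq {b : ℝ} (hb : 0 < b) :
    Continuous fun p : ℝ × ℝ => ((p.1 - p.2) ^ 2 + b ^ 2)⁻¹ :=
  Continuous.inv₀ (by fun_prop) fun p => by positivity

theorem integrable_prod_inv_sub_sq_add_sq {b : ℝ} (hb : 0 < b) (ν : Measure ℝ)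
    [IsFiniteMeasure ν] :
    Integrable (fun p : ℝ × ℝ => ((p.1 - p.2) ^ 2 + b ^ 2)⁻¹) (volume.prod ν) := by
  rw [integrable_prod_iff' (continuous_inv_sub_sq_add_sq hb).aestronglyMeasurable]
  refine ⟨ae_of_all _ fun t => (integrable_inv_sq_add_sq hb).comp_sub_right t, ?_⟩
  have : ∀ t : ℝ, ∫ u : ℝ, ‖((u - t) ^ 2 + b ^ 2)⁻¹‖ = Real.pi / b := by
    intro t
    rw [← integral_inv_sq_add_sq hb, ← integral_sub_right_eq_self (fun x => (x ^ 2 + b ^ 2)⁻¹) t]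
    congr 1
    ext u
    exact Real.norm_of_nonneg (by positivity)
  simp only [this]
  exact integrable_const _

theorem integral_integral_inv_sub_sq_add_sq {b : ℝ} (hb : 0 < b) (ν : Measure ℝ)
    [IsFiniteMeasure ν] :
    ∫ u : ℝ, ∫ t, ((u - t) ^ 2 + b ^ 2)⁻¹ ∂ν = Real.pi / b * ν.real Set.univ := by
  rw [integral_integral_swap (integrable_prod_inv_sub_sq_add_sq hb ν)]
  have : ∀ t : ℝ, ∫ u : ℝ, ((u - t) ^ 2 + b ^ 2)⁻¹ = Real.pi / b := fun t => by
    rw [← integral_inv_sq_add_sq hb, ← integral_sub_right_eq_self (fun x => (x ^ 2 + b ^ 2)⁻¹) t]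
  simp only [this, integral_const, smul_eq_mul]
  ring

theorem mul_resolvent_eq_cfc {z₁ z₂ z₃ : ℂ} (h₁ : z₁.im ≠ 0) (h₂ : z₂.im ≠ 0) (h₃ : z₃.im ≠ 0)
    (c : ℂ) :
    cfc (fun w => c * (resolventSymbol z₁ w * (resolventSymbol z₂ w * resolventSymbol z₃ w)))
      (cayley H hH) = c • (resolvent hH z₁ * (resolvent hH z₂ * resolvent hH z₃)) := by
  have c₁ := continuousOn_spectrum hH (continuousOn_resolventSymbol h₁)
  have c₂ := continuousOn_spectrum hH (continuousOn_resolventSymbol h₂)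
  have c₃ := continuousOn_spectrum hH (continuousOn_resolventSymbol h₃)
  have c₂₃ : ContinuousOn (fun w => resolventSymbol z₂ w * resolventSymbol z₃ w)
    (spectrum ℂ (cayley H hH)) := c₂.mul c₃
  have c₁₂₃ : ContinuousOn (fun w => resolventSymbol z₁ w * (resolventSymbol z₂ w *
    resolventSymbol z₃ w)) (spectrum ℂ (cayley H hH)) := c₁.mul c₂₃
  rw [cfc_const_mul c _ (cayley H hH) c₁₂₃, cfc_mul _ _ (cayley H hH) c₁ c₂₃, cfc_mul _ _ (cayley H hH) c₂ c₃]
  rfl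

/-- The Poisson-type kernel is `|t - u - ib|⁻²`, the symbol of `R* R` for the resolvent `R` at `u +
ib`. With Fubini this yields the exact `L²` norm of `Rφ` in `u`. -/
theorem integral_inv_sub_sq_add_sq_spectralMeasure {b : ℝ} (hb : 0 < b) (u : ℝ) (φ : E) :
    ∫ t, ((u - t) ^ 2 + b ^ 2)⁻¹ ∂spectralMeasure H hH φ =
      ‖resolvent hH (u + b * Complex.I) φ‖ ^ 2 := by
  have h₁ : ((u : ℂ) + b * Complex.I).im ≠ 0 := by simpa using hb.ne'
  have h₂ : (star ((u : ℂ) + b * Complex.I)).im ≠ 0 := by simpa using hb.ne'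
  have c₁ := continuousOn_resolventSymbol h₁
  have c₂ := continuousOn_resolventSymbol h₂
  have key := integral_spectralMeasure hH φ
    (G := fun t => (((u - t) ^ 2 + b ^ 2)⁻¹ : ℝ))
    (g := fun w => resolventSymbol (star ((u : ℂ) + b * Complex.I)) w *
      resolventSymbol ((u : ℂ) + b * Complex.I) w)
    (Complex.continuous_ofReal.comp
      ((continuous_inv_sub_sq_add_sq hb).comp (Continuous.prodMk_right u))).aestronglyMeasurable
    (c₂.mul c₁) (fun w hw hw1 => by
      rw [← resolventSymbol_eq hw hw1, ← resolventSymbol_eq hw hw1, ← mul_inv, Complex.ofReal_inv]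
      congr 1
      push_cast
      simp
      linear_combination (b : ℂ) ^ 2 * Complex.I_sq)
  rw [cfc_mul _ _ (cayley H hH) (continuousOn_spectrum hH c₂) (continuousOn_spectrum hH c₁),
    mul_apply_eq_comp, integral_complex_ofReal] at key
  change _ = inner ℂ φ (resolvent hH (star ((u : ℂ) + b * Complex.I)) (resolvent hH _ φ)) at key
  rw [← inner_resolvent_left, inner_self_eq_norm_sq_to_K] at key
  refine Complex.ofReal_injective (key.trans ?_)
  push_cast
  rfl

theorem norm_resolvent_star (ζ : ℂ) (φ : E) :
    ‖resolvent hH (star ζ) φ‖ = ‖resolvent hH ζ φ‖ := by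
  have hcomm : resolvent hH ζ * resolvent hH (star ζ) = resolvent hH (star ζ) * resolvent hH ζ :=
    cfc_commute_cfc _ _ _
  have h1 : inner ℂ (resolvent hH (star ζ) φ) (resolvent hH (star ζ) φ) =
      inner ℂ (resolvent hH ζ φ) (resolvent hH ζ φ) := by
    rw [inner_resolvent_left, inner_resolvent_left, star_star]
    exact congrArg (fun T : E →L[ℂ] E => inner ℂ φ (T φ)) hcomm
  rw [inner_self_eq_norm_sq_to_K, inner_self_eq_norm_sq_to_K] at h1
  have h2 : ‖resolvent hH (star ζ) φ‖ ^ 2 = ‖resolvent hH ζ φ‖ ^ 2 := by exact_mod_cast h1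
  exact (sq_eq_sq₀ (norm_nonneg _) (norm_nonneg _)).1 h2

theorem integrable_norm_resolvent_sq {b : ℝ} (hb : 0 < b) (φ : E) :
    Integrable fun u : ℝ => ‖resolvent hH (u + b * Complex.I) φ‖ ^ 2 := by
  simp only [← integral_inv_sub_sq_add_sq_spectralMeasure hH hb]
  exact (integrable_prod_inv_sub_sq_add_sq hb (spectralMeasure H hH φ)).integral_prod_left

theorem integral_norm_resolvent_sq {b : ℝ} (hb : 0 < b) (φ : E) :
    ∫ u : ℝ, ‖resolvent hH (u + b * Complex.I) φ‖ ^ 2 = Real.pi / b * ‖φ‖ ^ 2 := by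
  simp only [← integral_inv_sub_sq_add_sq_spectralMeasure hH hb]
  rw [integral_integral_inv_sub_sq_add_sq hb, measureReal_spectralMeasure_univ]

/-- The operator `∫ stripKernel F b u t dE_H(t)`. -/
def stripOperator (F : ℂ → ℂ) (b u : ℝ) : E →L[ℂ] E :=
  F (u + b * Complex.I) • (resolvent hH (u + b * Complex.I) *
      (resolvent hH (u + (3 * b : ℝ) * Complex.I) * resolvent hH (u + (-b : ℝ) * Complex.I)))
    - F (u - b * Complex.I) • (resolvent hH (u + b * Complex.I) *
      (resolvent hH (u + (-(3 * b) : ℝ) * Complex.I) * resolvent hH (u + (-b : ℝ) * Complex.I)))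

section

variable {F : ℂ → ℂ} {η b C : ℝ}

theorem integral_stripKernel_spectralMeasure (hb : 0 < b) (hbη : b < η)
    (hF : ContinuousOn F (strip η)) (u : ℝ) (χ : E) :
    ∫ t, stripKernel F b u t ∂spectralMeasure H hH χ =
      inner ℂ χ (stripOperator hH F b u χ) := by
  have him : ∀ c : ℝ, c ≠ 0 → ((u : ℂ) + c * Complex.I).im ≠ 0 := fun c hc => by simpa using hc
  have h₁ := him b hb.ne'
  have h₂ := him (-b) (by simp [hb.ne'])
  have h₃ := him (3 * b) (by positivity)
  have h₄ := him (-(3 * b)) (by simp [hb.ne'])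
  have c₁ := continuousOn_resolventSymbol h₁
  have c₂ := continuousOn_resolventSymbol h₂
  have c₃ := continuousOn_resolventSymbol h₃
  have c₄ := continuousOn_resolventSymbol h₄
  have d₁ : ContinuousOn (fun w => F (u + b * Complex.I) *
      (resolventSymbol (u + b * Complex.I) w * (resolventSymbol (u + (3 * b : ℝ) * Complex.I) w *
        resolventSymbol (u + (-b : ℝ) * Complex.I) w))) (Metric.sphere 0 1) :=
    continuousOn_const.mul (c₁.mul (c₃.mul c₂))
  have d₂ : ContinuousOn (fun w => F (u - b * Complex.I) *
      (resolventSymbol (u + b * Complex.I) w * (resolventSymbol (u + (-(3 * b) : ℝ) * Complex.I) w *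
        resolventSymbol (u + (-b : ℝ) * Complex.I) w))) (Metric.sphere 0 1) :=
    continuousOn_const.mul (c₁.mul (c₄.mul c₂))
  have d : ContinuousOn (fun w => F (u + b * Complex.I) *
      (resolventSymbol (u + b * Complex.I) w * (resolventSymbol (u + (3 * b : ℝ) * Complex.I) w *
        resolventSymbol (u + (-b : ℝ) * Complex.I) w)) - F (u - b * Complex.I) *
      (resolventSymbol (u + b * Complex.I) w * (resolventSymbol (u + (-(3 * b) : ℝ) * Complex.I) w *
        resolventSymbol (u + (-b : ℝ) * Complex.I) w))) (Metric.sphere 0 1) := d₁.sub d₂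
  rw [integral_spectralMeasure hH χ (G := fun t => stripKernel F b u t) ((continuous_stripKernel hb hbη hF).comp
    (Continuous.prodMk_right u)).aestronglyMeasurable d]
  · rw [cfc_sub _ _ (cayley H hH) (continuousOn_spectrum hH d₁) (continuousOn_spectrum hH d₂),
      mul_resolvent_eq_cfc hH h₁ h₃ h₂, mul_resolvent_eq_cfc hH h₁ h₄ h₂]
    rfl
  · intro w hw hw1
    simp only [← resolventSymbol_eq hw hw1, stripKernel]
    generalize cayleyInv w = t
    have e₁ := ofReal_add_mul_I_ne_zero hb.ne' (u - t)
    have e₂ := ofReal_add_mul_I_ne_zero (c := -b) (by simp [hb.ne']) (u - t)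
    have e₃ := ofReal_add_mul_I_ne_zero (c := 3 * b) (by positivity) (u - t)
    have e₄ := ofReal_add_mul_I_ne_zero (c := -(3 * b)) (by simp [hb.ne']) (u - t)
    generalize F (u + b * Complex.I) = F₁
    generalize F (u - b * Complex.I) = F₂
    push_cast at *
    -- Resolvent symbols are `1/(t - ζ)`, whereas the kernel is written in `u - t`; the three sign
    -- changes exchange the order of its two terms.
    have f₁ : (t : ℂ) - (u + b * Complex.I) = -(u - t + b * Complex.I) := by ring
    have f₂ : (t : ℂ) - (u + -b * Complex.I) = -(u - t + -b * Complex.I) := by ring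
    have f₃ : (t : ℂ) - (u + 3 * b * Complex.I) = -(u - t + 3 * b * Complex.I) := by ring
    have f₄ : (t : ℂ) - (u + -(3 * b) * Complex.I) = -(u - t + -(3 * b) * Complex.I) := by ring
    have f₅ : (u - t : ℂ) - 3 * b * Complex.I = u - t + -(3 * b) * Complex.I := by ring
    have f₆ : (u - t : ℂ) ^ 2 + b ^ 2 = (u - t + b * Complex.I) * (u - t + -b * Complex.I) := by
      linear_combination (b : ℂ) ^ 2 * Complex.I_sq
    rw [f₁, f₂, f₃, f₄, f₅, f₆]
    generalize (u - t : ℂ) + b * Complex.I = p at *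
    generalize (u - t : ℂ) + -b * Complex.I = q at *
    generalize (u - t : ℂ) + 3 * b * Complex.I = r at *
    generalize (u - t : ℂ) + -(3 * b) * Complex.I = v at *
    clear * - e₁ e₂ e₃ e₄
    field_simp
    ring

theorem integrable_prod_stripKernel (hb : 0 < b) (hbη : b < η) (hF : ContinuousOn F (strip η))
    (hC : ∀ z ∈ strip η, ‖F z‖ ≤ C) (ν : Measure ℝ) [IsFiniteMeasure ν] :
    Integrable (fun p : ℝ × ℝ => stripKernel F b p.1 p.2) (volume.prod ν) :=
  Integrable.mono' ((integrable_prod_inv_sub_sq_add_sq hb ν).const_mul (2 * C / (3 * b)))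
    (continuous_stripKernel hb hbη hF).aestronglyMeasurable
    (ae_of_all _ fun p => norm_stripKernel_le hb hbη hC p.1 p.2)

theorem integrable_inner_stripOperator (hb : 0 < b) (hbη : b < η)
    (hF : ContinuousOn F (strip η)) (hC : ∀ z ∈ strip η, ‖F z‖ ≤ C) (χ : E) :
    Integrable fun u : ℝ => inner ℂ χ (stripOperator hH F b u χ) := by
  simp only [← integral_stripKernel_spectralMeasure hH hb hbη hF]
  exact (integrable_prod_stripKernel hb hbη hF hC (spectralMeasure H hH χ)).integral_prod_left

theorem integral_spectralMeasure_eq (hb : 0 < b) (hbη : b < η)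
    (hF : DifferentiableOn ℂ F (strip η)) (hC : ∀ z ∈ strip η, ‖F z‖ ≤ C) (χ : E) :
    2 * Real.pi * Complex.I * ∫ t : ℝ, F t ∂spectralMeasure H hH χ =
      4 * b ^ 2 * ∫ u : ℝ, inner ℂ χ (stripOperator hH F b u χ) := by
  simp only [← integral_stripKernel_spectralMeasure hH hb hbη hF.continuousOn]
  rw [integral_integral_swap (integrable_prod_stripKernel hb hbη hF.continuousOn hC _),
    ← integral_const_mul, ← integral_const_mul]
  congr 1
  ext t
  exact (integral_stripKernel hb hbη hF hC t).symm

theorem integral_polarization {f₁ f₂ f₃ f₄ : ℝ → ℂ} (h₁ : Integrable f₁) (h₂ : Integrable f₂)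
    (h₃ : Integrable f₃) (h₄ : Integrable f₄) :
    ∫ u, (f₁ u - f₂ u - Complex.I * f₃ u + Complex.I * f₄ u) =
      (∫ u, f₁ u) - (∫ u, f₂ u) - Complex.I * (∫ u, f₃ u) + Complex.I * ∫ u, f₄ u := by
  have h₁₂ : Integrable fun u => f₁ u - f₂ u := h₁.sub h₂
  have h₃' := h₃.const_mul Complex.I
  have h₁₂₃ : Integrable fun u => f₁ u - f₂ u - Complex.I * f₃ u := h₁₂.sub h₃'
  rw [integral_add h₁₂₃ (h₄.const_mul _), integral_sub h₁₂ h₃', integral_sub h₁ h₂,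
    integral_const_mul, integral_const_mul]

/-- The contour representation of `F(H)`. -/
theorem matrixElement_eq_integral (hb : 0 < b) (hbη : b < η)
    (hF : DifferentiableOn ℂ F (strip η)) (hC : ∀ z ∈ strip η, ‖F z‖ ≤ C) (φ ψ : E) :
    2 * Real.pi * Complex.I * matrixElement H hH (fun t : ℝ => F t) φ ψ =
      4 * b ^ 2 * ∫ u : ℝ, inner ℂ φ (stripOperator hH F b u ψ) := by
  have hi := integrable_inner_stripOperator hH hb hbη hF.continuousOn hC
  have e := integral_spectralMeasure_eq hH hb hbη hF hC
  simp only [← polarization _ φ ψ]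
  rw [integral_const_mul, integral_polarization (hi (φ + ψ)) (hi (φ - ψ)) (hi (φ + Complex.I • ψ))
    (hi (φ - Complex.I • ψ)), matrixElement]
  linear_combination (1 / 4 : ℂ) * (e (φ + ψ) - e (φ - ψ) - Complex.I * e (φ + Complex.I • ψ)
    + Complex.I * e (φ - Complex.I • ψ))

/-- The hypothesis is in terms of squared norms because these integrate exactly over `u`. The
constant is `(4b²/2π) · 2Cκ · (π/b)`, with `2` for the two boundary lines. -/
theorem norm_matrixElement_le_of_resolvent (hb : 0 < b) (hbη : b < η)
    (hF : DifferentiableOn ℂ F (strip η)) (hC : ∀ z ∈ strip η, ‖F z‖ ≤ C) (φ ψ : E) {κ : ℝ}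
    (hκ : ∀ u c : ℝ, |c| = 3 * b → ‖inner ℂ φ (resolvent hH (u + b * Complex.I)
        (resolvent hH (u + c * Complex.I) (resolvent hH (u + (-b : ℝ) * Complex.I) ψ)))‖ ≤
      κ * (‖resolvent hH (u + b * Complex.I) φ‖ ^ 2 + ‖resolvent hH (u + b * Complex.I) ψ‖ ^ 2)) :
    ‖matrixElement H hH (fun t : ℝ => F t) φ ψ‖ ≤ 4 * b * C * κ * (‖φ‖ ^ 2 + ‖ψ‖ ^ 2) := by
  have hC0 : 0 ≤ C := (norm_nonneg _).trans (hC _ (sub_mul_I_mem_strip hb hbη 0))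
  have hbound : ‖∫ u : ℝ, inner ℂ φ (stripOperator hH F b u ψ)‖ ≤
      ∫ u : ℝ, 2 * C * κ * (‖resolvent hH (u + b * Complex.I) φ‖ ^ 2 +
        ‖resolvent hH (u + b * Complex.I) ψ‖ ^ 2) := by
    refine norm_integral_le_of_norm_le (((integrable_norm_resolvent_sq hH hb φ).add
      (integrable_norm_resolvent_sq hH hb ψ)).const_mul _) (ae_of_all _ fun u => ?_)
    have k₁ := hκ u (3 * b) (abs_of_pos (by positivity))
    have k₂ := hκ u (-(3 * b)) (by rw [abs_neg, abs_of_pos (by positivity)])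
    rw [stripOperator, sub_apply, smul_apply, smul_apply, inner_sub_right, inner_smul_right,
      inner_smul_right]
    refine (norm_sub_le _ _).trans ?_
    rw [norm_mul, norm_mul]
    have m₁ := mul_le_mul (hC _ (add_mul_I_mem_strip hb hbη u)) k₁ (norm_nonneg _) hC0
    have m₂ := mul_le_mul (hC _ (sub_mul_I_mem_strip hb hbη u)) k₂ (norm_nonneg _) hC0
    refine (add_le_add m₁ m₂).trans (le_of_eq ?_)
    ring
  rw [integral_const_mul, integral_add (integrable_norm_resolvent_sq hH hb φ)
    (integrable_norm_resolvent_sq hH hb ψ), integral_norm_resolvent_sq hH hb,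
    integral_norm_resolvent_sq hH hb] at hbound
  have key := congrArg norm (matrixElement_eq_integral hH hb hbη hF hC φ ψ)
  simp only [norm_mul, Complex.norm_I, mul_one, norm_pow, Complex.norm_real, Complex.norm_ofNat,
    Real.norm_of_nonneg hb.le, Real.norm_of_nonneg Real.pi_pos.le] at key
  have h2 : 2 * Real.pi * ‖matrixElement H hH (fun t : ℝ => F t) φ ψ‖ ≤
      2 * Real.pi * (4 * b * C * κ * (‖φ‖ ^ 2 + ‖ψ‖ ^ 2)) := by
    rw [key]
    refine (mul_le_mul_of_nonneg_left hbound (by positivity)).trans (le_of_eq ?_)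
    field_simp
  exact le_of_mul_le_mul_left h2 (by positivity)

end

end SelfAdjointCalculus

/-! ### Hopping operators on the lattice -/

namespace LatticeHamiltonian

variable {d : ℕ}

theorem summable_sq_norm_add (ψ : Hilb d) (a : Fin d → ℤ) :
    Summable fun x => ‖ψ (x + a)‖ ^ (2 : ℝ) := by
  have := (lp.memℓp ψ).summable (by norm_num)
  simp only [ENNReal.toReal_ofNat] at this
  exact (Equiv.addRight a).summable_iff.2 this

theorem mul_sq_norm_le {m : (Fin d → ℤ) → ℂ} {C : ℝ} (hm : ∀ x, ‖m x‖ ≤ C) (x : Fin d → ℤ)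
    (z : ℂ) : ‖m x * z‖ ^ (2 : ℝ) ≤ C ^ (2 : ℝ) * ‖z‖ ^ (2 : ℝ) := by
  rw [← Real.mul_rpow ((norm_nonneg _).trans (hm 0)) (norm_nonneg _), norm_mul]
  gcongr
  exact hm x

theorem memℓp_weightedShift {m : (Fin d → ℤ) → ℂ} (a : Fin d → ℤ) {C : ℝ} (hm : ∀ x, ‖m x‖ ≤ C)
    (ψ : Hilb d) : Memℓp (fun x => m x * ψ (x + a)) 2 := by
  refine memℓp_gen ?_
  simp only [ENNReal.toReal_ofNat]
  exact Summable.of_nonneg_of_le (fun x => by positivity) (fun x => mul_sq_norm_le hm x _)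
    ((summable_sq_norm_add ψ a).mul_left _)

/-- The linear map `(Tψ)(x) = m(x) ψ(x + a)`, for a bounded function `m`. -/
def weightedShiftLinear (m : (Fin d → ℤ) → ℂ) (a : Fin d → ℤ) (C : ℝ) (hm : ∀ x, ‖m x‖ ≤ C) :
    Hilb d →ₗ[ℂ] Hilb d where
  toFun ψ := ⟨fun x => m x * ψ (x + a), memℓp_weightedShift a hm ψ⟩
  map_add' ψ φ := lp.ext (funext fun x => mul_add (m x) (ψ (x + a)) (φ (x + a)))
  map_smul' c ψ := lp.ext (funext fun x => mul_left_comm (m x) c (ψ (x + a)))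

theorem weightedShiftLinear_apply (m : (Fin d → ℤ) → ℂ) (a : Fin d → ℤ) (C : ℝ)
    (hm : ∀ x, ‖m x‖ ≤ C) (ψ : Hilb d) (x : Fin d → ℤ) :
    weightedShiftLinear m a C hm ψ x = m x * ψ (x + a) := rfl

theorem norm_weightedShiftLinear_apply_le (m : (Fin d → ℤ) → ℂ) (a : Fin d → ℤ) (C : ℝ)
    (hm : ∀ x, ‖m x‖ ≤ C) (ψ : Hilb d) : ‖weightedShiftLinear m a C hm ψ‖ ≤ C * ‖ψ‖ := by
  have hC : 0 ≤ C := (norm_nonneg _).trans (hm 0)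
  refine lp.norm_le_of_tsum_le (by norm_num) (by positivity) ?_
  rw [Real.mul_rpow hC (norm_nonneg _), lp.norm_rpow_eq_tsum (by norm_num)]
  simp only [ENNReal.toReal_ofNat]
  have h1 : ∑' x, ‖ψ x‖ ^ (2 : ℝ) = ∑' x, ‖ψ (x + a)‖ ^ (2 : ℝ) :=
    ((Equiv.addRight a).tsum_eq fun x => ‖ψ x‖ ^ (2 : ℝ)).symm
  have h2 : ∀ x, ‖weightedShiftLinear m a C hm ψ x‖ ^ (2 : ℝ) ≤
      C ^ (2 : ℝ) * ‖ψ (x + a)‖ ^ (2 : ℝ) := fun x => mul_sq_norm_le hm x _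
  have h3 := (summable_sq_norm_add ψ a).mul_left (C ^ (2 : ℝ))
  rw [h1, ← tsum_mul_left]
  exact (Summable.of_nonneg_of_le (fun x => by positivity) h2 h3).tsum_le_tsum h2 h3

/-- The operator `(Tψ)(x) = m(x) ψ(x + a)`, for a bounded function `m`. -/
def weightedShift (m : (Fin d → ℤ) → ℂ) (a : Fin d → ℤ) (C : ℝ) (hm : ∀ x, ‖m x‖ ≤ C) :
    Hilb d →L[ℂ] Hilb d :=
  (weightedShiftLinear m a C hm).mkContinuous C (norm_weightedShiftLinear_apply_le m a C hm)

theorem weightedShift_apply (m : (Fin d → ℤ) → ℂ) (a : Fin d → ℤ) (C : ℝ) (hm : ∀ x, ‖m x‖ ≤ C)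
    (ψ : Hilb d) (x : Fin d → ℤ) : weightedShift m a C hm ψ x = m x * ψ (x + a) := by
  rw [weightedShift, LinearMap.mkContinuous_apply, weightedShiftLinear_apply]

theorem norm_weightedShift_le (m : (Fin d → ℤ) → ℂ) (a : Fin d → ℤ) (C : ℝ)
    (hm : ∀ x, ‖m x‖ ≤ C) : ‖weightedShift m a C hm‖ ≤ C :=
  LinearMap.mkContinuous_norm_le _ ((norm_nonneg _).trans (hm 0))
    (norm_weightedShiftLinear_apply_le m a C hm)

theorem inner_ket_left (x : Fin d → ℤ) (ψ : Hilb d) : inner ℂ (ket x) ψ = ψ x := by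
  have h : ∀ z : ℂ, inner ℂ (1 : ℂ) z = z := fun z => by simp
  exact (lp.inner_single_left x (1 : ℂ) ψ).trans (h _)

theorem norm_ket (x : Fin d → ℤ) : ‖ket x‖ = 1 := by
  rw [ket, lp.norm_single (by norm_num)]; simp

/-- The operator with the matrix elements `k x y`, dominated by a summable function of `y - x`. -/
def kernelOperator (k : (Fin d → ℤ) → (Fin d → ℤ) → ℂ) (g : (Fin d → ℤ) → ℝ)
    (hk : ∀ x a, ‖k x (x + a)‖ ≤ g a) : Hilb d →L[ℂ] Hilb d :=
  ∑' a, weightedShift (fun x => k x (x + a)) a (g a) fun x => hk x a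

section

variable {k : (Fin d → ℤ) → (Fin d → ℤ) → ℂ} {g : (Fin d → ℤ) → ℝ}
  (hk : ∀ x a, ‖k x (x + a)‖ ≤ g a)

theorem summable_weightedShift (hg : Summable g) :
    Summable fun a => weightedShift (fun x => k x (x + a)) a (g a) fun x => hk x a :=
  Summable.of_norm_bounded hg fun a => norm_weightedShift_le _ a _ fun x => hk x a

/-- A Schur-type bound: the diagonal `y - x = a` is a weighted shift of norm at most `g a`. -/
theorem norm_kernelOperator_le (hg : Summable g) : ‖kernelOperator k g hk‖ ≤ ∑' a, g a :=
  tsum_of_norm_bounded hg.hasSum fun a => norm_weightedShift_le _ a _ fun x => hk x a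

theorem hasSum_kernelOperator (hg : Summable g) (ψ : Hilb d) (x : Fin d → ℤ) :
    HasSum (fun y => k x y * ψ y) (kernelOperator k g hk ψ x) := by
  have h1 := ((summable_weightedShift hk hg).hasSum.mapL
    (ContinuousLinearMap.apply ℂ (Hilb d) ψ)).mapL (innerSL ℂ (ket x))
  rw [← (Equiv.addLeft x).hasSum_iff]
  have h2 : innerSL ℂ (ket x) (ContinuousLinearMap.apply ℂ (Hilb d) ψ
      (∑' a, weightedShift (fun x => k x (x + a)) a (g a) fun x => hk x a)) =
      kernelOperator k g hk ψ x := inner_ket_left x (kernelOperator k g hk ψ)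
  rw [h2] at h1
  refine h1.congr_fun fun a => ?_
  have h3 := inner_ket_left x (weightedShift (fun x => k x (x + a)) a (g a) (fun x => hk x a) ψ)
  rw [weightedShift_apply] at h3
  exact h3.symm

end

/-- Multiplication by a bounded function. -/
def mulOperator (m : (Fin d → ℤ) → ℂ) (C : ℝ) (hm : ∀ x, ‖m x‖ ≤ C) : Hilb d →L[ℂ] Hilb d :=
  weightedShift m 0 C hm

theorem mulOperator_apply (m : (Fin d → ℤ) → ℂ) (C : ℝ) (hm : ∀ x, ‖m x‖ ≤ C) (ψ : Hilb d)
    (x : Fin d → ℤ) : mulOperator m C hm ψ x = m x * ψ x := by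
  rw [mulOperator, weightedShift_apply, add_zero]

theorem mulOperator_ket (m : (Fin d → ℤ) → ℂ) (C : ℝ) (hm : ∀ x, ‖m x‖ ≤ C) (y : Fin d → ℤ) :
    mulOperator m C hm (ket y) = m y • ket y := by
  ext x
  rw [mulOperator_apply, lp.coeFn_smul, Pi.smul_apply, smul_eq_mul]
  by_cases hxy : x = y
  · rw [hxy]
  · rw [ket, lp.single_apply_ne _ _ _ hxy]; simp

/-- A norm on `ℝ^d` is bounded below on the nonzero lattice points. -/
theorem exists_pos_le_len (N : Seminorm ℝ (Fin d → ℝ)) (hN : ∀ v, N v = 0 → v = 0) :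
    ∃ c > 0, ∀ x : Fin d → ℤ, x ≠ 0 → c ≤ len N x := by
  have hcont : Continuous N := by
    have hconv : ConvexOn ℝ Set.univ N := N.convexOn
    exact continuousOn_univ.1 (hconv.continuousOn isOpen_univ)
  rcases (Metric.sphere (0 : Fin d → ℝ) 1).eq_empty_or_nonempty with he | hne
  -- An empty unit sphere means `d = 0`, where there is no nonzero lattice point.
  · refine ⟨1, one_pos, fun x hx => ?_⟩
    exfalso
    have hx' : (fun i => (x i : ℝ)) ≠ 0 := fun h => hx (by
      ext i; simpa using congrFun h i)
    have : ‖(fun i => (x i : ℝ))‖⁻¹ • (fun i => (x i : ℝ)) ∈ Metric.sphere (0 : Fin d → ℝ) 1 := by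
      rw [mem_sphere_zero_iff_norm, norm_smul, norm_inv, norm_norm,
        inv_mul_cancel₀ (norm_ne_zero_iff.2 hx')]
    rw [he] at this
    exact this
  · obtain ⟨v, hv, hmin⟩ := (isCompact_sphere (0 : Fin d → ℝ) 1).exists_isMinOn hne
      hcont.continuousOn
    have hv1 : ‖v‖ = 1 := by simpa using hv
    have hv0 : v ≠ 0 := by rintro rfl; simp at hv1
    refine ⟨N v, lt_of_le_of_ne (apply_nonneg N v) fun h => hv0 (hN v h.symm), fun x hx => ?_⟩
    set w : Fin d → ℝ := fun i => (x i : ℝ) with hw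
    have hw0 : w ≠ 0 := fun h => hx (by ext i; simpa [hw] using congrFun h i)
    have hw1 : 1 ≤ ‖w‖ := by
      obtain ⟨i, hi⟩ := Function.ne_iff.1 hx
      refine le_trans ?_ (norm_le_pi_norm w i)
      have h1 : (1 : ℤ) ≤ |x i| := Int.one_le_abs hi
      change 1 ≤ |(x i : ℝ)|
      exact_mod_cast h1
    have h1 : N v ≤ N (‖w‖⁻¹ • w) := hmin (by
      rw [mem_sphere_zero_iff_norm, norm_smul, norm_inv, norm_norm,
        inv_mul_cancel₀ (norm_ne_zero_iff.2 hw0)])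
    rw [map_smul_eq_mul, norm_inv, norm_norm, inv_mul_eq_div, le_div_iff₀ (by linarith)] at h1
    change N v ≤ N w
    nlinarith [apply_nonneg N v]

/-- Away from the origin lattice vectors have length at least some `c > 0`, so the weight `e^{μ|a|}
- 1` is bounded below. Thus the hopping part of `H` is bounded, and all unboundedness sits in the
diagonal. -/
theorem summable_norm_of_summable_bTerm {N : Seminorm ℝ (Fin d → ℝ)}
    (hN : ∀ v, N v = 0 → v = 0) {K : (Fin d → ℤ) → (Fin d → ℤ) → ℂ} {μ : ℝ} (hμ : 0 < μ)
    (hsum : Summable (bTerm N K μ)) : Summable fun a => ‖K 0 a‖ := by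
  obtain ⟨c, hc, hcN⟩ := exists_pos_le_len N hN
  have hpos : 0 < Real.exp (μ * c) - 1 := by
    have := Real.add_one_lt_exp (mul_pos hμ hc).ne'
    nlinarith [mul_pos hμ hc]
  refine Summable.of_norm_bounded_eventually (g := fun a => (Real.exp (μ * c) - 1)⁻¹ * bTerm N K μ a)
    (hsum.mul_left _) ?_
  rw [Filter.eventually_cofinite]
  refine (Set.finite_singleton (0 : Fin d → ℤ)).subset fun a ha => ?_
  by_contra ha0
  apply ha
  rw [norm_norm, bTerm, inv_mul_eq_div, le_div_iff₀ hpos]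
  gcongr
  exact hcN a ha0

theorem norm_hopping_eq {K : (Fin d → ℤ) → (Fin d → ℤ) → ℂ}
    (hK : ∀ a x y, ‖K (x + a) (y + a)‖ = ‖K x y‖) (x a : Fin d → ℤ) :
    ‖K x (x + a)‖ = ‖K 0 a‖ := by
  rw [← hK x 0 a, zero_add, add_comm a x]

section

variable {K : (Fin d → ℤ) → (Fin d → ℤ) → ℂ} {U : (Fin d → ℤ) → ℝ} {lam : ℝ}
  {V : (Fin d → ℤ) → ℝ} {H : Hilb d →ₗ.[ℂ] Hilb d}

theorem inner_apply_symm {E : Type*} [NormedAddCommGroup E] [InnerProductSpace ℂ E]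
    [CompleteSpace E] {H : E →ₗ.[ℂ] E} (hH : IsSelfAdjoint H) (φ ψ : H.domain) :
    inner ℂ (H φ) (ψ : E) = inner ℂ (φ : E) (H ψ) :=
  SelfAdjointCalculus.graph_inner hH ⟨(φ, H φ), H.mem_graph φ⟩ ⟨(ψ, H ψ), H.mem_graph ψ⟩

theorem hopping_conj (hH : IsHamiltonian K U lam V H) (x y : Fin d → ℤ) :
    (starRingEnd ℂ) (K y x) = K x y := by
  have h1 := inner_apply_symm hH.selfAdjoint ⟨ket x, hH.ket_mem x⟩ ⟨ket y, hH.ket_mem y⟩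
  rw [← inner_conj_symm, hH.matrix, hH.matrix, map_add] at h1
  by_cases hxy : x = y
  · subst hxy; simpa using h1
  · simpa [hxy, Ne.symm hxy] using h1

/-- The matrix elements of `H` determine its action on the whole domain. -/
theorem apply_eq_kernelOperator_add (hH : IsHamiltonian K U lam V H) {g : (Fin d → ℤ) → ℝ}
    (hk : ∀ x a, ‖K x (x + a)‖ ≤ g a) (hg : Summable g) (ψ : H.domain) (x : Fin d → ℤ) :
    H ψ x = kernelOperator K g hk ψ x + (U x + lam * V x : ℝ) * (ψ : Hilb d) x := by
  have h1 := inner_apply_symm hH.selfAdjoint ⟨ket x, hH.ket_mem x⟩ ψ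
  rw [inner_ket_left] at h1
  have h2 := lp.hasSum_inner (𝕜 := ℂ) (H ⟨ket x, hH.ket_mem x⟩) (ψ : Hilb d)
  rw [h1] at h2
  have h3 : ∀ y, inner ℂ (H ⟨ket x, hH.ket_mem x⟩ y) ((ψ : Hilb d) y) =
      K x y * (ψ : Hilb d) y + if y = x then (U x + lam * V x : ℝ) * (ψ : Hilb d) x else 0 := by
    intro y
    rw [← inner_ket_left y (H _), hH.matrix, RCLike.inner_apply, map_add, hopping_conj hH]
    by_cases hxy : y = x
    · subst hxy; simp; ring
    · simp [hxy]; ring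
  simp only [h3] at h2
  exact h2.unique ((hasSum_kernelOperator hk hg ψ x).add (hasSum_ite_eq x _))

end

end LatticeHamiltonian

/-! ### The Combes-Thomas estimate -/

namespace LatticeHamiltonian

open SelfAdjointCalculus

variable {d : ℕ}

/-- Multiplication by `e^f`, for a bounded real function `f`. -/
def expOperator (f : (Fin d → ℤ) → ℝ) (A : ℝ) (hf : ∀ x, |f x| ≤ A) : Hilb d →L[ℂ] Hilb d :=
  mulOperator (fun x => (Real.exp (f x) : ℂ)) (Real.exp A) fun x => by
    rw [Complex.norm_real, Real.norm_of_nonneg (Real.exp_pos _).le]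
    exact Real.exp_le_exp.2 ((le_abs_self _).trans (hf x))

theorem expOperator_apply (f : (Fin d → ℤ) → ℝ) (A : ℝ) (hf : ∀ x, |f x| ≤ A) (ψ : Hilb d)
    (x : Fin d → ℤ) : expOperator f A hf ψ x = (Real.exp (f x) : ℂ) * ψ x :=
  mulOperator_apply _ _ _ _ _

theorem expOperator_ket (f : (Fin d → ℤ) → ℝ) (A : ℝ) (hf : ∀ x, |f x| ≤ A) (y : Fin d → ℤ) :
    expOperator f A hf (ket y) = (Real.exp (f y) : ℂ) • ket y :=
  mulOperator_ket _ _ _ _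

theorem inner_expOperator_neg (f : (Fin d → ℤ) → ℝ) (A : ℝ) (hf : ∀ x, |f x| ≤ A)
    (hf' : ∀ x, |-f x| ≤ A) (φ ψ : Hilb d) :
    inner ℂ (expOperator (fun x => -f x) A hf' φ) (expOperator f A hf ψ) = inner ℂ φ ψ := by
  rw [lp.inner_eq_tsum, lp.inner_eq_tsum]
  refine tsum_congr fun x => ?_
  rw [expOperator_apply, expOperator_apply, RCLike.inner_apply, RCLike.inner_apply, map_mul,
    Complex.conj_ofReal, Real.exp_neg, Complex.ofReal_inv]
  have : (Real.exp (f x) : ℂ) ≠ 0 := by exact_mod_cast (Real.exp_pos _).ne'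
  field_simp

theorem abs_exp_sub_one_le_exp_abs (s : ℝ) : |Real.exp s - 1| ≤ Real.exp |s| - 1 := by
  rcases le_total 0 s with hs | hs
  · rw [abs_of_nonneg hs, abs_of_nonneg (by linarith [Real.one_le_exp hs])]
  · rw [abs_of_nonpos hs, abs_of_nonpos (by linarith [Real.exp_le_one_iff.2 hs])]
    have h1 := Real.exp_pos s
    have h2 : Real.exp (-s) * Real.exp s = 1 := by rw [← Real.exp_add]; simp
    nlinarith [sq_nonneg (Real.exp s - 1), Real.one_le_exp (neg_nonneg.2 hs)]

variable {N : Seminorm ℝ (Fin d → ℝ)} {K : (Fin d → ℤ) → (Fin d → ℤ) → ℂ}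
  {U : (Fin d → ℤ) → ℝ} {lam : ℝ} {V : (Fin d → ℤ) → ℝ} {H : Hilb d →ₗ.[ℂ] Hilb d} {μ : ℝ}
  {f : (Fin d → ℤ) → ℝ} {A : ℝ}

theorem kernelOperator_ket {k : (Fin d → ℤ) → (Fin d → ℤ) → ℂ} {g : (Fin d → ℤ) → ℝ}
    (hk : ∀ x a, ‖k x (x + a)‖ ≤ g a) (hg : Summable g) (x y : Fin d → ℤ) :
    kernelOperator k g hk (ket y) x = k x y := by
  have h1 := hasSum_kernelOperator hk hg (ket y) x
  have h2 := hasSum_single (f := fun z => k x z * ket y z) y fun z hz => by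
    rw [ket, lp.single_apply_ne _ _ _ hz, mul_zero]
  rw [h1.unique h2, ket, lp.single_apply_self, mul_one]

theorem kernelOperator_symm (hH : IsHamiltonian K U lam V H) {g : (Fin d → ℤ) → ℝ}
    (hk : ∀ x a, ‖K x (x + a)‖ ≤ g a) (hg : Summable g) (φ χ : Hilb d) :
    inner ℂ (kernelOperator K g hk φ) χ = inner ℂ φ (kernelOperator K g hk χ) := by
  rw [← ContinuousLinearMap.adjoint_inner_right]
  congr 1
  ext x
  rw [← inner_ket_left x, ContinuousLinearMap.adjoint_inner_right]
  refine (lp.hasSum_inner (𝕜 := ℂ) _ _).unique ?_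
  refine (hasSum_kernelOperator hk hg χ x).congr_fun fun y => ?_
  rw [kernelOperator_ket hk hg, RCLike.inner_apply, hopping_conj hH, mul_comm]

/-- The hopping terms of `e^f H e^{-f} - H`. -/
def conjugatedHopping (K : (Fin d → ℤ) → (Fin d → ℤ) → ℂ) (f : (Fin d → ℤ) → ℝ)
    (x y : Fin d → ℤ) : ℂ := K x y * ((Real.exp (f x - f y) - 1 : ℝ) : ℂ)

theorem norm_conjugatedHopping_le (hK : ∀ a x y, ‖K (x + a) (y + a)‖ = ‖K x y‖)
    (hL : ∀ x a, |f x - f (x + a)| ≤ μ * len N a) (x a : Fin d → ℤ) :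
    ‖conjugatedHopping K f x (x + a)‖ ≤ bTerm N K μ a := by
  rw [conjugatedHopping, norm_mul, norm_hopping_eq hK, bTerm, Complex.norm_real]
  gcongr
  exact (abs_exp_sub_one_le_exp_abs _).trans
    (sub_le_sub_right (Real.exp_le_exp.2 (hL x a)) 1)

theorem kernelOperator_conjugatedHopping {g g' : (Fin d → ℤ) → ℝ}
    (hk : ∀ x a, ‖K x (x + a)‖ ≤ g a) (hg : Summable g)
    (hk' : ∀ x a, ‖conjugatedHopping K f x (x + a)‖ ≤ g' a) (hg' : Summable g')
    (hf : ∀ x, |f x| ≤ A) (ψ : Hilb d) (x : Fin d → ℤ) :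
    kernelOperator (conjugatedHopping K f) g' hk' (expOperator f A hf ψ) x =
      (Real.exp (f x) : ℂ) * kernelOperator K g hk ψ x
        - kernelOperator K g hk (expOperator f A hf ψ) x := by
  refine (hasSum_kernelOperator hk' hg' _ x).unique
    ((((hasSum_kernelOperator hk hg ψ x).mul_left _).sub
      (hasSum_kernelOperator hk hg _ x)).congr_fun fun y => ?_)
  rw [expOperator_apply, conjugatedHopping, Real.exp_sub]
  have : (Real.exp (f y) : ℂ) ≠ 0 := by exact_mod_cast (Real.exp_pos _).ne'
  push_cast at this ⊢
  field_simp

/-- The hypothesis places `φ` in the domain of the adjoint with value `w`, and the adjoint is `H`.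
-/
theorem mem_domain_of_inner {E : Type*} [NormedAddCommGroup E] [InnerProductSpace ℂ E]
    [CompleteSpace E] {H : E →ₗ.[ℂ] E} (hH : IsSelfAdjoint H) {φ w : E}
    (h : ∀ χ : H.domain, inner ℂ w (χ : E) = inner ℂ φ (H χ)) :
    ∃ h : φ ∈ H.domain, H ⟨φ, h⟩ = w := by
  have hd := LinearPMap.mem_adjoint_domain_of_exists (T := H) φ ⟨_, h⟩
  have he := LinearPMap.adjoint_apply_eq hH.dense_domain ⟨φ, hd⟩ h
  have hmem : (φ, w) ∈ H.adjoint.graph := by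
    rw [← he]; exact H.adjoint.mem_graph ⟨φ, hd⟩
  rw [LinearPMap.isSelfAdjoint_def.1 hH] at hmem
  obtain ⟨a, ha1, ha2⟩ := H.mem_graph_iff.1 hmem
  dsimp only at ha1 ha2
  subst ha1
  exact ⟨a.2, ha2⟩

/-- The domain of `H` is invariant under `e^f`, and `e^f H e^{-f} - H` is the bounded operator with
the hopping terms `conjugatedHopping`. -/
theorem expOperator_mem_domain (hH : IsHamiltonian K U lam V H) {g g' : (Fin d → ℤ) → ℝ}
    (hk : ∀ x a, ‖K x (x + a)‖ ≤ g a) (hg : Summable g)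
    (hk' : ∀ x a, ‖conjugatedHopping K f x (x + a)‖ ≤ g' a) (hg' : Summable g')
    (hf : ∀ x, |f x| ≤ A) (ψ : H.domain) :
    ∃ h : expOperator f A hf ψ ∈ H.domain, H ⟨expOperator f A hf ψ, h⟩ =
      expOperator f A hf (H ψ)
        - kernelOperator (conjugatedHopping K f) g' hk' (expOperator f A hf ψ) := by
  refine mem_domain_of_inner hH.selfAdjoint fun χ => ?_
  set M := expOperator f A hf with hM
  set T := kernelOperator K g hk with hT
  set w := M (H ψ) - kernelOperator (conjugatedHopping K f) g' hk' (M ψ) with hw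
  -- Once the bounded symmetric hopping `T` is subtracted, only multiplication by the real potential
  -- remains. It commutes with `e^f` site by site, so no bound on the potential is needed.
  have hw1 : ∀ x, (w - T (M ψ)) x =
      (U x + lam * V x : ℝ) * ((Real.exp (f x) : ℂ) * (ψ : Hilb d) x) := by
    intro x
    rw [lp.coeFn_sub, Pi.sub_apply, hw, lp.coeFn_sub, Pi.sub_apply,
      kernelOperator_conjugatedHopping hk hg hk' hg' hf, expOperator_apply,
      apply_eq_kernelOperator_add hH hk hg]
    ring
  have hχ1 : ∀ x, (H χ - T χ) x = (U x + lam * V x : ℝ) * (χ : Hilb d) x := by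
    intro x
    rw [lp.coeFn_sub, Pi.sub_apply, apply_eq_kernelOperator_add hH hk hg]
    ring
  have h1 : inner ℂ (w - T (M ψ)) (χ : Hilb d) = inner ℂ (M ψ) (H χ - T χ) := by
    rw [lp.inner_eq_tsum, lp.inner_eq_tsum]
    refine tsum_congr fun x => ?_
    rw [hw1, hχ1, expOperator_apply, RCLike.inner_apply, RCLike.inner_apply]
    simp only [map_mul, Complex.conj_ofReal]
    ring
  rw [inner_sub_left, inner_sub_right, kernelOperator_symm hH hk hg] at h1
  linear_combination h1

/-- The Combes-Thomas estimate for vectors: conjugation by `e^f` does not increase the norm of a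
resolvent applied to a vector by more than a factor. -/
theorem norm_expOperator_resolvent_le (hN : ∀ v, N v = 0 → v = 0)
    (hK : ∀ a x y, ‖K (x + a) (y + a)‖ = ‖K x y‖) (hH : IsHamiltonian K U lam V H) (hμ : 0 < μ)
    (hsum : Summable (bTerm N K μ)) (hf : ∀ x, |f x| ≤ A)
    (hL : ∀ x a, |f x - f (x + a)| ≤ μ * len N a) {ζ : ℂ} (hζ : ζ.im ≠ 0) (φ : Hilb d) :
    (1 - (∑' x, bTerm N K μ x) / |ζ.im|) *
        ‖expOperator f A hf (resolvent hH.selfAdjoint ζ φ)‖ ≤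
      ‖resolvent hH.selfAdjoint ζ (expOperator f A hf φ)‖ := by
  have hk : ∀ x a, ‖K x (x + a)‖ ≤ ‖K 0 a‖ := fun x a => (norm_hopping_eq hK x a).le
  have hg := summable_norm_of_summable_bTerm hN hμ hsum
  have hk' := norm_conjugatedHopping_le hK hL
  obtain ⟨h, h'⟩ := resolvent_mem_domain hH.selfAdjoint hζ φ
  obtain ⟨j, j'⟩ := expOperator_mem_domain hH hk hg hk' hsum hf
    ⟨resolvent hH.selfAdjoint ζ φ, h⟩
  -- Since `(H - ζ) M R φ = M φ - B M R φ`, applying `R` gives `M R φ = R M φ - R B M R φ`; the last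
  -- term is absorbed on the left.
  have key := resolvent_sub_smul hH.selfAdjoint hζ ⟨_, j⟩
  rw [j', h'] at key
  set R := resolvent hH.selfAdjoint ζ
  set M := expOperator f A hf
  set B := kernelOperator (conjugatedHopping K f) (bTerm N K μ) hk'
  dsimp only at key
  have e : M (φ + ζ • R φ) - B (M (R φ)) - ζ • M (R φ) = M φ - B (M (R φ)) := by
    rw [map_add, map_smul]; abel
  rw [e, map_sub] at key
  have hR : ‖R‖ ≤ |ζ.im|⁻¹ := norm_resolvent_le hH.selfAdjoint hζ
  have hB : ‖B‖ ≤ ∑' x, bTerm N K μ x := norm_kernelOperator_le hk' hsum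
  have h1 : ‖R (B (M (R φ)))‖ ≤ (∑' x, bTerm N K μ x) / |ζ.im| * ‖M (R φ)‖ :=
    calc ‖R (B (M (R φ)))‖ ≤ ‖R‖ * (‖B‖ * ‖M (R φ)‖) :=
          (R.le_opNorm _).trans (mul_le_mul_of_nonneg_left (B.le_opNorm _) (norm_nonneg _))
      _ ≤ |ζ.im|⁻¹ * ((∑' x, bTerm N K μ x) * ‖M (R φ)‖) := by gcongr
      _ = _ := by ring
  have h2 : ‖M (R φ)‖ ≤ ‖R (M φ)‖ + ‖R (B (M (R φ)))‖ := by
    conv_lhs => rw [← key]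
    exact norm_sub_le _ _
  linarith

theorem len_zero : len N 0 = 0 := by
  have : (fun i => (((0 : Fin d → ℤ) i : ℤ) : ℝ)) = 0 := by ext; simp
  rw [len, this, map_zero]

theorem abs_len_sub_len_le (u v : Fin d → ℤ) : |len N u - len N v| ≤ len N (v - u) := by
  have : (fun i => (((v - u) i : ℤ) : ℝ)) = (fun i => (v i : ℝ)) - fun i => (u i : ℝ) := by
    ext; simp
  rw [len, len, len, this, abs_sub_comm]
  exact abs_sub_map_le_sub N _ _

theorem len_nonneg (x : Fin d → ℤ) : 0 ≤ len N x := apply_nonneg N _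

/-- The distance to `y` multiplied by `μ`, cut off at its value at `x`. -/
def cutDist (N : Seminorm ℝ (Fin d → ℝ)) (μ : ℝ) (x y u : Fin d → ℤ) : ℝ :=
  μ * min (len N (u - y)) (len N (x - y))

theorem abs_cutDist_le (hμ : 0 < μ) (x y u : Fin d → ℤ) :
    |cutDist N μ x y u| ≤ μ * len N (x - y) := by
  have h : 0 ≤ min (len N (u - y)) (len N (x - y)) := le_min (len_nonneg _) (len_nonneg _)
  rw [cutDist, abs_of_nonneg (by positivity)]
  gcongr
  exact min_le_right _ _

theorem abs_cutDist_sub_le (hμ : 0 < μ) (x y u a : Fin d → ℤ) :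
    |cutDist N μ x y u - cutDist N μ x y (u + a)| ≤ μ * len N a := by
  rw [cutDist, cutDist, ← mul_sub, abs_mul, abs_of_pos hμ]
  gcongr
  have h1 := abs_min_sub_min_le_max (len N (u - y)) (len N (x - y)) (len N (u + a - y))
    (len N (x - y))
  have h2 := abs_len_sub_len_le (N := N) (u - y) (u + a - y)
  rw [sub_sub_sub_cancel_right, add_sub_cancel_left] at h2
  rw [sub_self, abs_zero] at h1
  exact h1.trans (max_le h2 (len_nonneg _))

/-- Exponential decay of the matrix elements of a product of three resolvents. -/
theorem norm_inner_resolvent_le (hN : ∀ v, N v = 0 → v = 0)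
    (hK : ∀ a x y, ‖K (x + a) (y + a)‖ = ‖K x y‖) (hH : IsHamiltonian K U lam V H) {η : ℝ}
    (hη : 0 < η) (hμ : 0 < μ) (hsum : Summable (bTerm N K μ))
    (hb : ∑' x, bTerm N K μ x ≤ η / 2) (x y : Fin d → ℤ) {b : ℝ} (hbη : b = 3 * η / 4) (u c : ℝ)
    (hc : |c| = 3 * b) :
    ‖inner ℂ (ket x) (resolvent hH.selfAdjoint (u + b * Complex.I)
        (resolvent hH.selfAdjoint (u + c * Complex.I)
          (resolvent hH.selfAdjoint (u + (-b : ℝ) * Complex.I) (ket y))))‖ ≤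
      27 / (14 * b) * Real.exp (-μ * len N (x - y)) *
        (‖resolvent hH.selfAdjoint (u + b * Complex.I) (ket x)‖ ^ 2 +
          ‖resolvent hH.selfAdjoint (u + b * Complex.I) (ket y)‖ ^ 2) := by
  have hb0 : 0 < b := by rw [hbη]; positivity
  have hc0 : c ≠ 0 := by rintro rfl; rw [abs_zero] at hc; linarith
  -- The cutoff keeps `e^f` bounded without changing the value at `x`.
  set f := cutDist N μ x y with hfdef
  have hf : ∀ v, |f v| ≤ μ * len N (x - y) := abs_cutDist_le hμ x y
  have hf' : ∀ v, |-f v| ≤ μ * len N (x - y) := fun v => by rw [abs_neg]; exact hf v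
  have hL : ∀ v a, |f v - f (v + a)| ≤ μ * len N a := abs_cutDist_sub_le hμ x y
  have hL' : ∀ v a, |-f v - -f (v + a)| ≤ μ * len N a := fun v a => by
    rw [← neg_sub', abs_neg]; exact hL v a
  have hfx : f x = μ * len N (x - y) := by rw [hfdef, cutDist, min_self]
  have hfy : f y = 0 := by
    rw [hfdef, cutDist, sub_self, len_zero, min_eq_left (len_nonneg _), mul_zero]
  have him : ∀ s : ℝ, s ≠ 0 → ((u : ℂ) + s * Complex.I).im ≠ 0 := fun s hs => by simpa using hs
  have habs : ∀ s : ℝ, |((u : ℂ) + s * Complex.I).im| = |s| := fun s => by simp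
  have hstar : star ((u : ℂ) + b * Complex.I) = u + (-b : ℝ) * Complex.I := by simp
  set R : ℝ → Hilb d →L[ℂ] Hilb d := fun s => resolvent hH.selfAdjoint (u + s * Complex.I) with hR
  have hRstar : ∀ φ, ‖R (-b) φ‖ = ‖R b φ‖ := fun φ => by
    have := norm_resolvent_star hH.selfAdjoint ((u : ℂ) + b * Complex.I) φ
    rwa [hstar] at this
  set M := expOperator f _ hf
  set M' := expOperator (fun v => -f v) _ hf'
  have hfac : ∀ {s β q : ℝ}, |s| = β → 0 < β → q ≤ 1 - η / 2 / β → ∀ {X Y : ℝ}, 0 ≤ X →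
      (1 - (∑' x, bTerm N K μ x) / |((u : ℂ) + s * Complex.I).im|) * X ≤ Y → q * X ≤ Y := by
    intro s β q hs hβ hq X Y hX h
    rw [habs, hs] at h
    refine le_trans (mul_le_mul_of_nonneg_right (hq.trans ?_) hX) h
    gcongr
  -- With `b = 3η/4`, the perturbation of size `η/2` is `2/3` of the distance `b` and `2/9` of the
  -- distance `3b`.
  have q₁ : (1 / 3 : ℝ) ≤ 1 - η / 2 / b := by
    rw [hbη]; apply le_of_eq; field_simp; norm_num
  have q₂ : (7 / 9 : ℝ) ≤ 1 - η / 2 / (3 * b) := by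
    rw [hbη]; apply le_of_eq; field_simp; norm_num
  have hnb : -b ≠ 0 := neg_ne_zero.2 hb0.ne'
  have hnb' : |-b| = b := by rw [abs_neg, abs_of_pos hb0]
  -- All the decay arises here: `e^{-f}` acts on `|x⟩` as the scalar `e^{-μ|x-y|}`. On the other
  -- side `e^f` fixes `|y⟩`.
  have e₁ : 1 / 3 * ‖M' (R (-b) (ket x))‖ ≤ Real.exp (-μ * len N (x - y)) * ‖R b (ket x)‖ := by
    have := hfac hnb' hb0 q₁ (norm_nonneg _)
      (norm_expOperator_resolvent_le hN hK hH hμ hsum hf' hL' (him _ hnb) (ket x))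
    refine this.trans (le_of_eq ?_)
    rw [expOperator_ket, map_smul, norm_smul, Complex.norm_real,
      Real.norm_of_nonneg (Real.exp_pos _).le, hfx, neg_mul]
    congr 1
    exact hRstar _
  have e₂ : 1 / 3 * ‖M (R (-b) (ket y))‖ ≤ ‖R b (ket y)‖ := by
    have := hfac hnb' hb0 q₁ (norm_nonneg _)
      (norm_expOperator_resolvent_le hN hK hH hμ hsum hf hL (him _ hnb) (ket y))
    refine this.trans (le_of_eq ?_)
    rw [expOperator_ket, hfy, Real.exp_zero, Complex.ofReal_one, one_smul]
    exact hRstar _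
  have e₃ : 7 / 9 * ‖M (R c (R (-b) (ket y)))‖ ≤ (3 * b)⁻¹ * ‖M (R (-b) (ket y))‖ := by
    have := hfac hc (by positivity) q₂ (norm_nonneg _)
      (norm_expOperator_resolvent_le hN hK hH hμ hsum hf hL (him _ hc0) (R (-b) (ket y)))
    refine this.trans ((ContinuousLinearMap.le_opNorm _ _).trans ?_)
    gcongr
    have h := norm_resolvent_le hH.selfAdjoint (him _ hc0)
    rwa [habs, hc] at h
  -- The first resolvent moves to the left as its adjoint, and then `e^{-f}` and `e^{f}` are put on
  -- the two sides.
  have e₄ : inner ℂ (ket x) (R b (R c (R (-b) (ket y)))) =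
      inner ℂ (M' (R (-b) (ket x))) (M (R c (R (-b) (ket y)))) := by
    rw [inner_expOperator_neg f _ hf hf']
    have := inner_resolvent_left hH.selfAdjoint (ζ := (u : ℂ) + (-b : ℝ) * Complex.I) (ket x)
      (R c (R (-b) (ket y)))
    rw [← hstar, star_star, hstar] at this
    exact this.symm
  change ‖inner ℂ (ket x) (R b (R c (R (-b) (ket y))))‖ ≤
    27 / (14 * b) * Real.exp (-μ * len N (x - y)) * (‖R b (ket x)‖ ^ 2 + ‖R b (ket y)‖ ^ 2)
  rw [e₄]
  refine (norm_inner_le_norm _ _).trans ?_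
  have e₅ : ‖M (R c (R (-b) (ket y)))‖ ≤ 9 / (7 * b) * ‖R b (ket y)‖ := by
    have : (3 * b)⁻¹ * ‖M (R (-b) (ket y))‖ ≤ (3 * b)⁻¹ * (3 * ‖R b (ket y)‖) := by
      gcongr; linarith
    have h2 : (3 * b)⁻¹ * (3 * ‖R b (ket y)‖) = 7 / 9 * (9 / (7 * b) * ‖R b (ket y)‖) := by
      field_simp
    linarith
  have e₆ : ‖M' (R (-b) (ket x))‖ ≤ 3 * (Real.exp (-μ * len N (x - y)) * ‖R b (ket x)‖) := by
    linarith
  calc ‖M' (R (-b) (ket x))‖ * ‖M (R c (R (-b) (ket y)))‖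
      ≤ 3 * (Real.exp (-μ * len N (x - y)) * ‖R b (ket x)‖) * (9 / (7 * b) * ‖R b (ket y)‖) := by
        gcongr
    _ = 27 / (14 * b) * Real.exp (-μ * len N (x - y)) *
        (2 * ‖R b (ket x)‖ * ‖R b (ket y)‖) := by field_simp; ring
    _ ≤ _ := by
        gcongr
        exact two_mul_le_add_sq _ _

end LatticeHamiltonian

end

/-! ### Conclusion -/

theorem theorem3 {d : ℕ} (N : Seminorm ℝ (Fin d → ℝ)) (hN : ∀ v, N v = 0 → v = 0)
    (K : (Fin d → ℤ) → (Fin d → ℤ) → ℂ) (hK : ∀ a x y, ‖K (x + a) (y + a)‖ = ‖K x y‖)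
    (U : (Fin d → ℤ) → ℝ) (lam : ℝ) (V : (Fin d → ℤ) → ℝ)
    (H : LatticeHamiltonian.Hilb d →ₗ.[ℂ] LatticeHamiltonian.Hilb d)
    (hH : LatticeHamiltonian.IsHamiltonian K U lam V H)
    (η : ℝ) (hη : 0 < η) (F : ℂ → ℂ)
    (hF : AnalyticOnNhd ℂ F (LatticeHamiltonian.strip η))
    (hFb : BddAbove ((fun z => ‖F z‖) '' LatticeHamiltonian.strip η))
    (μ : ℝ) (hsum : Summable (LatticeHamiltonian.bTerm N K μ))
    (hμ : ∑' x, LatticeHamiltonian.bTerm N K μ x ≤ η / 2)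
    (x y : Fin d → ℤ) :
    ‖SelfAdjointCalculus.matrixElement H hH.selfAdjoint (fun t : ℝ => F t)
        (LatticeHamiltonian.ket x) (LatticeHamiltonian.ket y)‖ ≤
      18 * Real.sqrt 2 * LatticeHamiltonian.supNorm η F *
        Real.exp (-μ * LatticeHamiltonian.len N (x - y)) := by
  have hC : ∀ z ∈ LatticeHamiltonian.strip η, ‖F z‖ ≤ LatticeHamiltonian.supNorm η F :=
    fun z hz => le_csSup hFb ⟨z, hz, rfl⟩
  have hreal : ∀ t : ℝ, (t : ℂ) ∈ LatticeHamiltonian.strip η := fun t => by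
    simpa [LatticeHamiltonian.strip] using hη
  have hC0 : 0 ≤ LatticeHamiltonian.supNorm η F := (norm_nonneg _).trans (hC _ (hreal 0))
  have hs : (1 : ℝ) ≤ Real.sqrt 2 := by
    rw [Real.one_le_sqrt]; norm_num
  -- For `μ ≤ 0` the exponential is at least `1`, and the trivial bound `2‖F‖_∞` suffices.
  rcases le_or_gt μ 0 with hμ0 | hμ0
  · refine (SelfAdjointCalculus.norm_matrixElement_le hH.selfAdjoint
      (fun t => hC _ (hreal t)) _ _).trans ?_
    rw [LatticeHamiltonian.norm_ket, LatticeHamiltonian.norm_ket]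
    have h1 : 1 ≤ Real.exp (-μ * LatticeHamiltonian.len N (x - y)) :=
      Real.one_le_exp (mul_nonneg (neg_nonneg.2 hμ0) (LatticeHamiltonian.len_nonneg _))
    calc LatticeHamiltonian.supNorm η F * (1 ^ 2 + 1 ^ 2)
        ≤ 18 * 1 * LatticeHamiltonian.supNorm η F * 1 := by linarith
      _ ≤ _ := by gcongr
  -- The height must lie strictly between `η/2`, for the Combes-Thomas factor, and `η`, for
  -- analyticity. At `3η/4` the total constant is `4b · 27/(14b) · 2 = 108/7 ≤ 18√2`.
  · have hb : 0 < 3 * η / 4 := by positivity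
    refine (SelfAdjointCalculus.norm_matrixElement_le_of_resolvent hH.selfAdjoint hb
      (by linarith) hF.differentiableOn hC _ _ fun u c hc =>
      LatticeHamiltonian.norm_inner_resolvent_le hN hK hH hη hμ0 hsum hμ x y rfl u c hc).trans ?_
    rw [LatticeHamiltonian.norm_ket, LatticeHamiltonian.norm_ket]
    generalize 3 * η / 4 = b at hb
    have h2 : 4 * b * LatticeHamiltonian.supNorm η F *
        (27 / (14 * b) * Real.exp (-μ * LatticeHamiltonian.len N (x - y))) * (1 ^ 2 + 1 ^ 2) =
        108 / 7 * LatticeHamiltonian.supNorm η F *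
          Real.exp (-μ * LatticeHamiltonian.len N (x - y)) := by
      field_simp
      ring
    rw [h2]
    gcongr
    linarith
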